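/- For $f\colon\mathbb{R}^2\to\mathbb{R}$ let $\operatorname{graph}(f)=\{(x,y,f(x,y)) : x,y\in\mathbb{R}\}\subseteq\mathbb{R}^3$, and for $c>0$ let $f(c\,\cdot)$ denote the function $(x,y)\mapsto f(cx,cy)$. For a set $C\subseteq(0,\infty)$ we say that $f$ is *horizontally rigid for $C$* if for every $c\in C$ there is an isometry $\varphi$ of $\mathbb{R}^3$ (with the Euclidean metric) such that $\varphi(\operatorname{graph}(f))=\operatorname{graph}(f(c\,\cdot))$; $f$ is *horizontally rigid* if it is horizontally rigid for $(0,\infty)$. We say that $C$ *condensates to $\infty$* if for every $r\in\mathbb{R}$ the set $C\cap(r,\infty)$ is uncountable. **Theorem.** Let $f\colon\mathbb{R}^2\to\mathbb{R}$ be continuous. 1. If $C\subseteq(0,\infty)$ condensates to $\infty$, then $f$ is horizontally rigid for $C$ if and only if there are $a,b,d\in\mathbb{R}$ such that $f(x,y)=a+bx+dy$ for all $(x,y)\in\mathbb{R}^2$. 2. In particular, $f$ is horizontally rigid if and only if there are $a,b,d\in\mathbb{R}$ such that $f(x,y)=a+bx+dy$ for all $(x,y)\in\mathbb{R}^2$.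 -/

import Mathlib

/-- The graph of `f : ℝⁿ → ℝ`, as a subset of Euclidean space `ℝⁿ⁺¹`
(the last coordinate is the value of `f` at the first `n` coordinates). -/
def euclideanGraph {n : ℕ} (f : EuclideanSpace ℝ (Fin n) → ℝ) :
    Set (EuclideanSpace ℝ (Fin (n + 1))) :=
  {p | p (Fin.last n) = f (WithLp.toLp 2 fun i : Fin n => p i.castSucc)}

/-- `f : ℝⁿ → ℝ` is horizontally rigid for `C` via elements of `G`, a set of isometries of
`ℝⁿ⁺¹`: for every `c ∈ C` some `φ ∈ G` maps `graph(f)` onto `graph(f(c ·))`. -/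
def HorizontallyRigidVia {n : ℕ} (C : Set ℝ)
    (G : Set (EuclideanSpace ℝ (Fin (n + 1)) ≃ᵢ EuclideanSpace ℝ (Fin (n + 1))))
    (f : EuclideanSpace ℝ (Fin n) → ℝ) : Prop :=
  ∀ c ∈ C, ∃ φ ∈ G, φ '' euclideanGraph f = euclideanGraph fun x => f (c • x)

/-- Horizontally rigid for `C`, via arbitrary isometries of `ℝⁿ⁺¹`. -/
def HorizontallyRigidFor {n : ℕ} (C : Set ℝ) (f : EuclideanSpace ℝ (Fin n) → ℝ) : Prop :=
  HorizontallyRigidVia C Set.univ f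

/-- Horizontally rigid: horizontally rigid for `(0, ∞)`. -/
def HorizontallyRigid {n : ℕ} (f : EuclideanSpace ℝ (Fin n) → ℝ) : Prop :=
  HorizontallyRigidFor (Set.Ioi 0) f

/-- `C` condensates to `∞`: `C ∩ (r, ∞)` is uncountable for every real `r`. -/
def CondensatesToInfinity (C : Set ℝ) : Prop :=
  ∀ r : ℝ, ¬ (C ∩ Set.Ioi r).Countable

open Filter Topology

/-! The invariant behind the proof is `recCone f`, a closed convex cone containing the upward
vertical ray. An isometry between graphs carries epigraph to epigraph or to hypograph, so up to sign
its linear part Q carries one recession cone to the other (`exists_congruence`). Dilating `f` by c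
divides the horizontal parts of the cone by c (`mem_recCone_dilate`), and for large c a linear
isometry can rarely imitate this squeeze.

If the cone contains no line, its vectors have nonnegative height (`height_nonneg`), and it equals
the cone of each dilate considered. It is therefore a horizontal cone plus the vertical ray. The
vector Q⁻¹(`vert`) spans an extreme ray, which must be vertical or horizontal, and a pointed
horizontal cone has at most two extreme rays. Among three dilates and `f` itself, two thus share
their vertical axis. Then `f` is invariant, up to sign and a constant, under a contraction of the
plane, so it is constant (`const_of_axis`).

If the cone contains a line, `f` is a linear term of slope s in one direction plus a function g of
the transverse coordinate (`exists_cylinder`). Unless g is affine this line is unique, Q respects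
it, and the graphs of g / √(1 + s²) and g(c ·) / √(1 + s²c²) are congruent in the plane
(`exists_planarCongruence`). If the slopes of g are bounded on both sides, the planar cone is a
half-plane, making g affine, or a proper angle, whose preservation allows at most one c > 1
(`angle_eq`). Otherwise only two rotations are possible, one of them recurs for arbitrarily large c,
and g becomes self-similar. Since √(1 + s²c²) is not a power of c unless s = 0, three dilates force
g to be constant (`const_of_three_selfSimilar`). -/

/-! ### Horizontal and vertical coordinates -/

abbrev Plane := EuclideanSpace ℝ (Fin 2)

abbrev Space := EuclideanSpace ℝ (Fin 3)

/-- The horizontal part of a point of space. -/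
def hor : Space →ₗ[ℝ] Plane where
  toFun p := WithLp.toLp 2 fun i : Fin 2 => p i.castSucc
  map_add' _ _ := rfl
  map_smul' _ _ := rfl

/-- The point of space with horizontal part `x` and height `z`. -/
def pt (x : Plane) (z : ℝ) : Space := !₂[x 0, x 1, z]

/-- The vertical unit vector. -/
def vert : Space := pt 0 1

@[simp] lemma hor_apply_zero (p : Space) : hor p 0 = p 0 := rfl

@[simp] lemma hor_apply_one (p : Space) : hor p 1 = p 1 := rfl

@[simp] lemma pt_apply_two (x : Plane) (z : ℝ) : pt x z 2 = z := rfl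

@[simp] lemma hor_pt (x : Plane) (z : ℝ) : hor (pt x z) = x := by
  ext i; fin_cases i <;> rfl

@[simp] lemma hor_vert : hor vert = 0 := hor_pt _ _

@[simp] lemma vert_apply_two : vert 2 = 1 := rfl

lemma space_ext {p q : Space} (h : hor p = hor q) (h2 : p 2 = q 2) : p = q := by
  ext i
  fin_cases i
  · exact congrArg (fun x : Plane => x 0) h
  · exact congrArg (fun x : Plane => x 1) h
  · exact h2

lemma pt_hor (p : Space) : pt (hor p) (p 2) = p := space_ext (by simp) (by simp)

@[fun_prop] lemma continuous_hor : Continuous hor := hor.continuous_of_finiteDimensional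

@[fun_prop] lemma continuous_pt : Continuous fun q : Plane × ℝ => pt q.1 q.2 := by
  unfold pt
  refine (PiLp.continuous_toLp 2 _).comp (continuous_pi fun i => ?_)
  fin_cases i <;> simp <;> fun_prop

lemma space_inner (p q : Space) : inner ℝ p q = inner ℝ (hor p) (hor q) + p 2 * q 2 := by
  simp [PiLp.inner_apply, Fin.sum_univ_three, Fin.sum_univ_two]; ring

lemma inner_vert (p : Space) : inner ℝ p vert = p 2 := by simp [space_inner]

lemma space_norm_sq (p : Space) : ‖p‖ ^ 2 = ‖hor p‖ ^ 2 + p 2 ^ 2 := by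
  rw [← real_inner_self_eq_norm_sq, ← real_inner_self_eq_norm_sq, space_inner]; ring

lemma norm_hor_le (p : Space) : ‖hor p‖ ≤ ‖p‖ := by
  refine le_of_sq_le_sq ?_ (norm_nonneg _)
  rw [space_norm_sq]; nlinarith [sq_nonneg (p 2)]

lemma norm_vert : ‖vert‖ = 1 := by
  have h := space_norm_sq vert
  simp at h
  rcases h with h | h
  · exact h
  · linarith [norm_nonneg vert]

lemma mem_graph {f : Plane → ℝ} {p : Space} : p ∈ euclideanGraph f ↔ p 2 = f (hor p) := Iff.rfl

/-! ### Recession cones -/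

/-- The recession cone of the epigraph of `f`. -/
def recCone (f : Plane → ℝ) : Set Space :=
  {w | ∀ x : Plane, ∀ t : ℝ, 0 ≤ t → f (x + t • hor w) ≤ f x + t * w 2}

section RecCone

variable {f : Plane → ℝ}

lemma add_mem_recCone {a b : Space} (ha : a ∈ recCone f) (hb : b ∈ recCone f) :
    a + b ∈ recCone f := by
  intro x t ht
  have h1 := ha x t ht
  have h2 := hb (x + t • hor a) t ht
  rw [map_add, smul_add, ← add_assoc, PiLp.add_apply]
  linarith

lemma smul_mem_recCone {a : Space} (ha : a ∈ recCone f) {r : ℝ} (hr : 0 ≤ r) :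
    r • a ∈ recCone f := by
  intro x t ht
  have := ha x (t * r) (by positivity)
  rw [map_smul, smul_smul, PiLp.smul_apply, smul_eq_mul]
  linarith

lemma vert_mem_recCone : vert ∈ recCone f := by
  intro x t ht
  simp [ht]

lemma nonneg_of_mem_recCone_of_hor_eq_zero {w : Space} (hw : w ∈ recCone f) (h : hor w = 0) :
    0 ≤ w 2 := by
  have := hw 0 1 zero_le_one
  simp [h] at this
  exact this

lemma isClosed_recCone (hf : Continuous f) : IsClosed (recCone f) := by
  simp only [recCone, Set.ofPred_forall]
  refine isClosed_iInter fun x => isClosed_iInter fun t => isClosed_iInter fun _ => ?_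
  exact isClosed_le (by fun_prop) (by fun_prop)

lemma mem_recCone_iff_epigraph {w : Space} :
    w ∈ recCone f ↔ ∀ p : Space, ∀ t : ℝ, 0 ≤ t → f (hor p) ≤ p 2 →
      f (hor (p + t • w)) ≤ (p + t • w) 2 := by
  constructor
  · intro h p t ht hp
    have := h (hor p) t ht
    simp only [map_add, map_smul, PiLp.add_apply, PiLp.smul_apply, smul_eq_mul]
    linarith
  · intro h x t ht
    have := h (pt x (f x)) t ht (by simp)
    simpa using this

/-- The complement of a set stable under translation by tw is stable under translation by −tw. This
serves the isometries that exchange the two sides of the graphs. -/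
lemma mem_recCone_iff_hypograph {w : Space} :
    w ∈ recCone f ↔ ∀ p : Space, ∀ t : ℝ, 0 ≤ t → p 2 ≤ f (hor p) →
      (p - t • w) 2 ≤ f (hor (p - t • w)) := by
  constructor
  · intro h p t ht hp
    have := h (hor p - t • hor w) t ht
    simp only [map_sub, map_smul, PiLp.sub_apply, PiLp.smul_apply, smul_eq_mul, sub_add_cancel]
      at this ⊢
    linarith
  · intro h x t ht
    have := h (pt (x + t • hor w) (f (x + t • hor w))) t ht (by simp)
    simp at this
    linarith

lemma mem_recCone_dilate {c : ℝ} {w : Space} :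
    w ∈ recCone (fun x => f (c • x)) ↔ pt (c • hor w) (w 2) ∈ recCone f := by
  rcases eq_or_ne c 0 with rfl | hc
  · simp [recCone]
  constructor
  · intro h x t ht
    have := h (c⁻¹ • x) t ht
    simpa [smul_add, smul_smul, hc, mul_comm] using this
  · intro h x t ht
    have := h (c • x) t ht
    simpa [smul_add, smul_smul, hc, mul_comm] using this

end RecCone

/-! ### Action of graph isometries on recession cones -/

lemma pos_or_neg_of_isPreconnected {X : Type*} [TopologicalSpace X] {s : Set X}
    (hs : IsPreconnected s) {h : X → ℝ} (hh : Continuous h) (h0 : ∀ x ∈ s, h x ≠ 0) :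
    (∀ x ∈ s, 0 < h x) ∨ ∀ x ∈ s, h x < 0 := by
  by_contra! H
  obtain ⟨⟨x, hx, hx0⟩, y, hy, hy0⟩ := H
  obtain ⟨z, hz, hz0⟩ := hs.intermediate_value hx hy hh.continuousOn ⟨hx0, hy0⟩
  exact h0 z hz hz0

lemma isPreconnected_epigraph {f : Plane → ℝ} (hf : Continuous f) :
    IsPreconnected {p : Space | f (hor p) < p 2} := by
  have : {p : Space | f (hor p) < p 2} =
      (fun q : Plane × ℝ => pt q.1 (f q.1 + q.2)) '' (Set.univ ×ˢ Set.Ioi 0) := by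
    ext p
    constructor
    · intro hp
      refine ⟨(hor p, p 2 - f (hor p)), ⟨trivial, Set.mem_Ioi.2 (sub_pos.2 hp)⟩, ?_⟩
      simp [pt_hor]
    · rintro ⟨⟨x, t⟩, ⟨-, ht⟩, rfl⟩
      simpa using ht
  rw [this]
  refine (isPreconnected_univ.prod isPreconnected_Ioi).image _ (Continuous.continuousOn ?_)
  exact continuous_pt.comp (f := fun q : Plane × ℝ => (q.1, f q.1 + q.2)) (by fun_prop)

lemma isPreconnected_hypograph {f : Plane → ℝ} (hf : Continuous f) :
    IsPreconnected {p : Space | p 2 < f (hor p)} := by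
  have : {p : Space | p 2 < f (hor p)} =
      (fun q : Plane × ℝ => pt q.1 (f q.1 - q.2)) '' (Set.univ ×ˢ Set.Ioi 0) := by
    ext p
    constructor
    · intro hp
      refine ⟨(hor p, f (hor p) - p 2), ⟨trivial, Set.mem_Ioi.2 (sub_pos.2 hp)⟩, ?_⟩
      simp [pt_hor]
    · rintro ⟨⟨x, t⟩, ⟨-, ht⟩, rfl⟩
      simpa using ht
  rw [this]
  refine (isPreconnected_univ.prod isPreconnected_Ioi).image _ (Continuous.continuousOn ?_)
  exact continuous_pt.comp (f := fun q : Plane × ℝ => (q.1, f q.1 - q.2)) (by fun_prop)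

/-- A homeomorphism carrying one graph to another carries the epigraph to the epigraph or to
the hypograph. -/
lemma epigraph_iff_or {f g : Plane → ℝ} (hf : Continuous f) (hg : Continuous g)
    {φ : Space → Space} (hφ : Continuous φ) (hs : Function.Surjective φ)
    (h : ∀ p, p 2 = f (hor p) ↔ (φ p) 2 = g (hor (φ p))) :
    (∀ p, f (hor p) ≤ p 2 ↔ g (hor (φ p)) ≤ (φ p) 2) ∨
      ∀ p, f (hor p) ≤ p 2 ↔ (φ p) 2 ≤ g (hor (φ p)) := by
  have hc : Continuous fun p => (φ p) 2 - g (hor (φ p)) := by fun_prop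
  have h1 := pos_or_neg_of_isPreconnected (isPreconnected_epigraph hf) hc
    (fun p hp => by rw [sub_ne_zero, Ne, ← h]; exact (ne_of_lt hp).symm)
  have h2 := pos_or_neg_of_isPreconnected (isPreconnected_hypograph hf) hc
    (fun p hp => by rw [sub_ne_zero, Ne, ← h]; exact ne_of_lt hp)
  simp only [Set.mem_ofPred_eq, sub_pos, sub_neg] at h1 h2
  -- Surjectivity gives points mapped strictly above and strictly below the graph of `g`, so the two
  -- sides of the graph of `f` cannot land on the same side.
  obtain ⟨a, ha⟩ := hs (pt 0 (g 0 + 1))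
  obtain ⟨b, hb⟩ := hs (pt 0 (g 0 - 1))
  have ha' : g (hor (φ a)) < (φ a) 2 := by simp [ha]
  have hb' : (φ b) 2 < g (hor (φ b)) := by simp [hb]
  rcases h1 with h1 | h1 <;> rcases h2 with h2 | h2
  · rcases lt_trichotomy (b 2) (f (hor b)) with H | H | H
    · linarith [h2 b H]
    · linarith [(h b).1 H]
    · linarith [h1 b H]
  · left
    intro p
    rcases lt_trichotomy (p 2) (f (hor p)) with H | H | H
    · exact iff_of_false (by linarith) (by linarith [h2 p H])
    · exact iff_of_true (by linarith) (by linarith [(h p).1 H])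
    · exact iff_of_true (by linarith) (by linarith [h1 p H])
  · right
    intro p
    rcases lt_trichotomy (p 2) (f (hor p)) with H | H | H
    · exact iff_of_false (by linarith) (by linarith [h2 p H])
    · exact iff_of_true (by linarith) (by linarith [(h p).1 H])
    · exact iff_of_true (by linarith) (by linarith [h1 p H])
  · rcases lt_trichotomy (a 2) (f (hor a)) with H | H | H
    · linarith [h2 a H]
    · linarith [(h a).1 H]
    · linarith [h1 a H]

/-- The isometry `p ↦ σ • Q p + τ`, with `σ = ±1`, carries the graph of `f` to the graph of `g`,
and its linear part `Q` carries the recession cone of `f` to that of `g`. -/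
structure Congruence (f g : Plane → ℝ) (Q : Space ≃ₗᵢ[ℝ] Space) (σ : ℝ) (τ : Space) : Prop where
  sign : σ = 1 ∨ σ = -1
  graph_iff : ∀ p, p 2 = f (hor p) ↔ (σ • Q p + τ) 2 = g (hor (σ • Q p + τ))
  recCone_iff : ∀ w, w ∈ recCone f ↔ Q w ∈ recCone g

lemma Congruence.refl (f : Plane → ℝ) :
    Congruence f f (LinearIsometryEquiv.refl ℝ Space) 1 0 :=
  ⟨Or.inl rfl, fun p => by simp, fun w => Iff.rfl⟩

lemma exists_congruence {f g : Plane → ℝ} (hf : Continuous f) (hg : Continuous g)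
    {φ : Space ≃ᵢ Space} (h : φ '' euclideanGraph f = euclideanGraph g) :
    ∃ Q σ τ, Congruence f g Q σ τ := by
  have hG : ∀ p, p 2 = f (hor p) ↔ (φ p) 2 = g (hor (φ p)) := by
    intro p
    rw [← mem_graph, ← mem_graph, ← h, φ.injective.mem_set_image]
  set O : Space ≃ₗᵢ[ℝ] Space := φ.toRealAffineIsometryEquiv.linearIsometryEquiv with hO
  have hadd : ∀ p w, φ (p + w) = φ p + O w := by
    intro p w
    have := φ.toRealAffineIsometryEquiv.map_vadd p w
    simpa [add_comm] using this
  have hφ : ∀ p, φ p = O p + φ 0 := fun p => by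
    have := hadd 0 p
    rwa [zero_add, add_comm] at this
  rcases epigraph_iff_or hf hg φ.continuous φ.surjective hG with H | H
  · refine ⟨O, 1, φ 0, Or.inl rfl, fun p => ?_, fun w => ?_⟩
    · rw [one_smul, ← hφ]; exact hG p
    · rw [mem_recCone_iff_epigraph, mem_recCone_iff_epigraph]
      refine Iff.trans ?_ φ.surjective.forall.symm
      refine forall_congr' fun p => forall_congr' fun t => forall_congr' fun _ => ?_
      rw [H, H, hadd, map_smul]
  -- The sides are exchanged here, so it is −O that matches the recession cones; σ = −1 restores the
  -- original isometry.
  · refine ⟨O.trans (LinearIsometryEquiv.neg ℝ), -1, φ 0, Or.inr rfl, fun p => ?_, fun w => ?_⟩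
    · have : (-1 : ℝ) • (O.trans (LinearIsometryEquiv.neg ℝ)) p + φ 0 = φ p := by
        rw [hφ p]; simp
      rw [this]; exact hG p
    · rw [mem_recCone_iff_epigraph, mem_recCone_iff_hypograph]
      refine Iff.trans ?_ φ.surjective.forall.symm
      refine forall_congr' fun p => forall_congr' fun t => forall_congr' fun _ => ?_
      have : φ p - t • (O.trans (LinearIsometryEquiv.neg ℝ)) w = φ (p + t • w) := by
        rw [hadd, map_smul]; simp
      rw [H, H, this]

/-! ### Contractions and self-similar functions -/

/-- A continuous function unchanged up to sign by a contraction is constant. -/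
lemma const_of_contracting {X : Type*} [MetricSpace X] [CompleteSpace X] [Nonempty X]
    {f : X → ℝ} (hf : Continuous f) {K : NNReal} {S : X → X} (hS : ContractingWith K S)
    (h : ∀ x y, |f x - f y| = |f (S x) - f (S y)|) (x y : X) : f x = f y := by
  have key : ∀ z, f z = f (hS.fixedPoint S) := by
    intro z
    set a := hS.fixedPoint S
    have hit : ∀ n : ℕ, |f z - f a| = |f (S^[n] z) - f a| := by
      intro n
      induction n with
      | zero => rfl
      | succ n ih =>
        rw [ih, h, Function.iterate_succ_apply']
        rw [show S a = a from hS.fixedPoint_isFixedPt]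
    have hl : Tendsto (fun n : ℕ => |f (S^[n] z) - f a|) atTop (𝓝 |f a - f a|) :=
      (((hf.tendsto a).comp (hS.tendsto_iterate_fixedPoint z)).sub_const _).abs
    simp only [← hit, sub_self, abs_zero] at hl
    have := tendsto_nhds_unique hl tendsto_const_nhds
    linarith [abs_eq_zero.1 this.symm]
  rw [key x, key y]

/-- `g` is, up to sign and constants, `κ` times its composition with a similarity of ratio `ρ`. -/
def SelfSimilar (g : ℝ → ℝ) (κ ρ : ℝ) : Prop :=
  ∃ ε d : ℝ, (ε = 1 ∨ ε = -1) ∧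
    ∀ x y, |g x - g y| = κ * |g (ε * ρ * x + d) - g (ε * ρ * y + d)|

lemma SelfSimilar.const {g : ℝ → ℝ} (hg : Continuous g) {ρ : ℝ} (h0 : 0 < ρ) (h1 : ρ < 1)
    (h : SelfSimilar g 1 ρ) (x y : ℝ) : g x = g y := by
  obtain ⟨ε, d, hε, H⟩ := h
  have hS : ContractingWith ⟨ρ, h0.le⟩ fun x => ε * ρ * x + d := by
    refine ⟨by exact_mod_cast h1, LipschitzWith.of_dist_le_mul fun x y => ?_⟩
    rw [Real.dist_eq, Real.dist_eq]
    have : |ε| = 1 := by rcases hε with rfl | rfl <;> simp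
    rw [show ε * ρ * x + d - (ε * ρ * y + d) = ε * ρ * (x - y) by ring, abs_mul, abs_mul, this,
      abs_of_pos h0, one_mul]
    rfl
  exact const_of_contracting hg hS (by simpa using H) x y

/-- The center is the fixed point d / (1 − ερ) of the similarity. -/
lemma SelfSimilar.exists_center {g : ℝ → ℝ} {κ ρ : ℝ} (h1 : 0 < ρ) (h2 : ρ < 1)
    (h : SelfSimilar g κ ρ) :
    ∃ ε a : ℝ, (ε = 1 ∨ ε = -1) ∧ ∀ u, |g (a + u) - g a| = κ * |g (a + ε * ρ * u) - g a| := by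
  obtain ⟨ε, d, hε, H⟩ := h
  have hne : 1 - ε * ρ ≠ 0 := by rcases hε with rfl | rfl <;> intro h <;> linarith
  refine ⟨ε, d / (1 - ε * ρ), hε, fun u => ?_⟩
  rw [H]
  have e1 : ε * ρ * (d / (1 - ε * ρ)) + d = d / (1 - ε * ρ) := by field_simp; ring
  rw [mul_add, add_right_comm, e1]

/-- Upper growth bound for a self-similar function. -/
lemma SelfSimilar.growth_le {g : ℝ → ℝ} (hg : Continuous g) {κ ρ q : ℝ} (h1 : 0 < ρ) (h2 : ρ < 1)
    (hκ : 0 < κ) (hq : 0 ≤ q) (hle : κ * ρ ^ q ≤ 1) (h : SelfSimilar g κ ρ) :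
    ∃ a A : ℝ, 0 ≤ A ∧ ∀ u, |g (a + u) - g a| ≤ A * (1 + |u|) ^ q := by
  obtain ⟨ε, a, hε, H⟩ := h.exists_center h1 h2
  have hεa : |ε| = 1 := by rcases hε with rfl | rfl <;> simp
  obtain ⟨M, hM⟩ := (isCompact_Icc (a := (-1 : ℝ)) (b := 1)).exists_bound_of_continuousOn
    (f := fun u => g (a + u) - g a) (by fun_prop)
  have hM0 : 0 ≤ M := (norm_nonneg _).trans (hM 0 (by simp))
  have hρq : 0 < ρ ^ q := Real.rpow_pos_of_pos h1 q
  have hM' : ∀ u, |u| ≤ 1 → |g (a + u) - g a| ≤ M := fun u hu => hM u (abs_le.1 hu)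
  -- Multiplication by ερ brings an outer point into the shell ρ ≤ |u| ≤ 1. Each step costs a factor
  -- κ in the increment and gains ρ^q in the bound, and κρ^q ≤ 1.
  have step : ∀ n : ℕ, ∀ u, ρ ≤ |u| → ρ ^ n * |u| ≤ 1 →
      |g (a + u) - g a| ≤ M / ρ ^ q * |u| ^ q := by
    intro n
    have base : ∀ u, ρ ≤ |u| → |u| ≤ 1 → |g (a + u) - g a| ≤ M / ρ ^ q * |u| ^ q := by
      intro u hu hu1
      have : ρ ^ q ≤ |u| ^ q := Real.rpow_le_rpow h1.le hu hq
      calc _ ≤ M := hM' u hu1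
        _ = M / ρ ^ q * ρ ^ q := by field_simp
        _ ≤ _ := by gcongr
    induction n with
    | zero => intro u hu hu1; exact base u hu (by simpa using hu1)
    | succ n ih =>
      intro u hu hu1
      rcases le_or_gt |u| 1 with h' | h'
      · exact base u hu h'
      have e : |ε * ρ * u| = ρ * |u| := by rw [abs_mul, abs_mul, hεa, abs_of_pos h1, one_mul]
      have := ih (ε * ρ * u) (by rw [e]; nlinarith) (by rw [e]; rw [pow_succ] at hu1; linarith)
      rw [e, Real.mul_rpow h1.le (abs_nonneg u)] at this
      rw [H]
      calc _ ≤ κ * (M / ρ ^ q * (ρ ^ q * |u| ^ q)) := by gcongr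
        _ = (κ * ρ ^ q) * (M / ρ ^ q * |u| ^ q) := by ring
        _ ≤ 1 * (M / ρ ^ q * |u| ^ q) := by gcongr
        _ = _ := one_mul _
  refine ⟨a, M + M / ρ ^ q, by positivity, fun u => ?_⟩
  have hone : 1 ≤ (1 + |u|) ^ q := Real.one_le_rpow (by linarith [abs_nonneg u]) hq
  rcases le_or_gt |u| 1 with hu | hu
  · calc _ ≤ M := hM' u hu
      _ ≤ (M + M / ρ ^ q) * 1 := by have : 0 ≤ M / ρ ^ q := by positivity
                                    linarith
      _ ≤ _ := by gcongr
  · obtain ⟨n, hn⟩ := exists_pow_lt_of_lt_one (show 0 < |u|⁻¹ by positivity) h2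
    have := step n u (by linarith) (by
      calc ρ ^ n * |u| ≤ |u|⁻¹ * |u| := by gcongr
        _ = 1 := inv_mul_cancel₀ (by positivity))
    calc _ ≤ _ := this
      _ ≤ (M + M / ρ ^ q) * (1 + |u|) ^ q := by gcongr <;> linarith

/-- A function that is self-similar with two incompatible exponents is constant. -/
lemma SelfSimilar.const_of_exponents {g : ℝ → ℝ} (hg : Continuous g) {κ ρ κ' ρ' q : ℝ}
    (h1 : 0 < ρ) (h2 : ρ < 1) (hκ : 0 < κ) (hq : 0 ≤ q) (hle : κ * ρ ^ q ≤ 1)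
    (h : SelfSimilar g κ ρ) (h1' : 0 < ρ') (h2' : ρ' < 1)
    (hlt : 1 < κ' * ρ' ^ q) (h' : SelfSimilar g κ' ρ') (x y : ℝ) : g x = g y := by
  obtain ⟨a, A, hA, hA'⟩ := h.growth_le hg h1 h2 hκ hq hle
  obtain ⟨ε, b, hε, H⟩ := h'.exists_center h1' h2'
  have hεa : |ε| = 1 := by rcases hε with rfl | rfl <;> simp
  have hε2 : ε * ε = 1 := by rcases hε with rfl | rfl <;> simp
  suffices key : ∀ u, g (b + u) = g b by
    rw [show x = b + (x - b) by ring, show y = b + (y - b) by ring, key, key]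
  intro u
  by_contra hne
  have hpos : 0 < |g (b + u) - g b| := abs_pos.2 (sub_ne_zero.2 hne)
  -- Going outwards from b, increments grow by κ' per step and distances by 1/ρ'. As κ'ρ'^q > 1,
  -- this outruns growth of order q.
  have hit : ∀ n : ℕ, |g (b + (ε / ρ') ^ n * u) - g b| = κ' ^ n * |g (b + u) - g b| := by
    intro n
    induction n with
    | zero => simp
    | succ n ih =>
      rw [H, show ε * ρ' * ((ε / ρ') ^ (n + 1) * u) = (ε / ρ') ^ n * u by
        rw [pow_succ]; field_simp; rw [pow_two, hε2, one_mul], ih, pow_succ]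
      ring
  set L := 1 + |b - a| + |u| with hL
  set D := |g b - g a| with hD
  have hbound : ∀ n : ℕ, (κ' * ρ' ^ q) ^ n * |g (b + u) - g b| ≤ A * L ^ q + D := by
    intro n
    have hρn : 0 < ρ' ^ n := pow_pos h1' n
    have hρn1 : ρ' ^ n ≤ 1 := pow_le_one₀ h1'.le h2'.le
    have hnq : (ρ' ^ n) ^ q = (ρ' ^ q) ^ n := by
      rw [← Real.rpow_natCast, ← Real.rpow_natCast, ← Real.rpow_mul h1'.le,
        ← Real.rpow_mul h1'.le, mul_comm]
    have h3 := hA' (b - a + (ε / ρ') ^ n * u)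
    rw [show a + (b - a + (ε / ρ') ^ n * u) = b + (ε / ρ') ^ n * u by ring] at h3
    have h4 : |g (b + (ε / ρ') ^ n * u) - g b| ≤
        A * (1 + |b - a + (ε / ρ') ^ n * u|) ^ q + D := by
      have := abs_sub_le (g (b + (ε / ρ') ^ n * u)) (g a) (g b)
      rw [abs_sub_comm (g a)] at this
      linarith
    have h5 : 1 + |b - a + (ε / ρ') ^ n * u| ≤ L / ρ' ^ n := by
      rw [le_div_iff₀ hρn]
      have h6 : |b - a + (ε / ρ') ^ n * u| ≤ |b - a| + |u| / ρ' ^ n := by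
        refine (abs_add_le _ _).trans ?_
        rw [abs_mul, abs_pow, abs_div, hεa, abs_of_pos h1', div_pow, one_pow]
        apply le_of_eq; ring
      have h7 : (1 + |b - a|) * ρ' ^ n ≤ (1 + |b - a|) * 1 := by gcongr
      have h8 : |u| / ρ' ^ n * ρ' ^ n = |u| := by field_simp
      nlinarith
    rw [hit] at h4
    have h9 : (1 + |b - a + (ε / ρ') ^ n * u|) ^ q * (ρ' ^ n) ^ q ≤ L ^ q := by
      rw [← Real.mul_rpow (by positivity) hρn.le]
      exact Real.rpow_le_rpow (by positivity) ((le_div_iff₀ hρn).1 h5) hq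
    have h10 : (ρ' ^ n) ^ q ≤ 1 := Real.rpow_le_one hρn.le hρn1 hq
    have h11 : 0 ≤ (ρ' ^ n) ^ q := by positivity
    have h12 : 0 ≤ D := abs_nonneg _
    rw [mul_pow, ← hnq]
    calc κ' ^ n * (ρ' ^ n) ^ q * |g (b + u) - g b|
        = (κ' ^ n * |g (b + u) - g b|) * (ρ' ^ n) ^ q := by ring
      _ ≤ (A * (1 + |b - a + (ε / ρ') ^ n * u|) ^ q + D) * (ρ' ^ n) ^ q := by gcongr
      _ = A * ((1 + |b - a + (ε / ρ') ^ n * u|) ^ q * (ρ' ^ n) ^ q) + D * (ρ' ^ n) ^ q := by ring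
      _ ≤ A * L ^ q + D * 1 := by gcongr
      _ = _ := by ring
  obtain ⟨n, hn⟩ := (((tendsto_pow_atTop_atTop_of_one_lt hlt).atTop_mul_const hpos).eventually
    (eventually_gt_atTop (A * L ^ q + D))).exists
  exact absurd (hbound n) (not_le.2 hn)

/-- Bernoulli's inequality in the form of a strict tangent bound for `c ↦ √(1 + s² c²)` in
logarithmic coordinates. -/
lemma rpow_lt_sqrt_ratio {s c c₂ : ℝ} (hs : s ≠ 0) (hc : 0 < c) (hc₂ : 0 < c₂) (hne : c ≠ c₂) :
    (c / c₂) ^ (s ^ 2 * c₂ ^ 2 / (1 + s ^ 2 * c₂ ^ 2)) <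
      √(1 + s ^ 2 * c ^ 2) / √(1 + s ^ 2 * c₂ ^ 2) := by
  -- q is the logarithmic derivative of √(1 + s²c²) at c₂, that is, the slope of the tangent.
  set q := s ^ 2 * c₂ ^ 2 / (1 + s ^ 2 * c₂ ^ 2) with hq
  have hsc : 0 < s ^ 2 * c₂ ^ 2 := by positivity
  have hq0 : 0 < q := by positivity
  have hq1 : q < 1 := by rw [hq, div_lt_one (by positivity)]; linarith
  have hr : 0 < c / c₂ := by positivity
  have hr1 : c / c₂ ≠ 1 := by rwa [Ne, div_eq_one_iff_eq hc₂.ne']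
  have := rpow_one_add_lt_one_add_mul_self (s := (c / c₂) ^ 2 - 1) (by nlinarith) (by
    intro h
    have : (c / c₂ - 1) * (c / c₂ + 1) = 0 := by linarith
    rcases mul_eq_zero.1 this with h | h
    · exact hr1 (by linarith)
    · linarith) hq0 hq1
  rw [← Real.sqrt_div' _ (by positivity)]
  apply Real.lt_sqrt_of_sq_lt
  rw [← Real.rpow_natCast, ← Real.rpow_mul hr.le, mul_comm, Real.rpow_mul hr.le, Real.rpow_natCast]
  convert this using 1
  · ring_nf
  · rw [hq]; field_simp; ring

/-- A function whose dilates by `cᵢ` divided by `√(1 + s² cᵢ²)` agree up to isometries of the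
line, for three values of `c`, is constant. -/
lemma const_of_three_selfSimilar {g : ℝ → ℝ} (hg : Continuous g) {s c₁ c₂ c₃ : ℝ}
    (h₁ : 0 < c₁) (h₁₂ : c₁ < c₂) (h₂₃ : c₂ < c₃)
    (H₁₂ : SelfSimilar g (√(1 + s ^ 2 * c₂ ^ 2) / √(1 + s ^ 2 * c₁ ^ 2)) (c₁ / c₂))
    (H₂₃ : SelfSimilar g (√(1 + s ^ 2 * c₃ ^ 2) / √(1 + s ^ 2 * c₂ ^ 2)) (c₂ / c₃)) (x y : ℝ) :
    g x = g y := by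
  have h₂ : 0 < c₂ := h₁.trans h₁₂
  have h₃ : 0 < c₃ := h₂.trans h₂₃
  rcases eq_or_ne s 0 with rfl | hs
  · simp at H₁₂
    exact H₁₂.const hg (by positivity) ((div_lt_one h₂).2 h₁₂) x y
  -- Both comparisons use the tangent at the middle value c₂: the pair c₁, c₂ bounds the growth of
  -- `g` by order q, and the pair c₂, c₃ exceeds it.
  · have e1 := rpow_lt_sqrt_ratio hs h₁ h₂ h₁₂.ne
    have e2 := rpow_lt_sqrt_ratio hs h₃ h₂ h₂₃.ne'
    set q := s ^ 2 * c₂ ^ 2 / (1 + s ^ 2 * c₂ ^ 2) with hq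
    refine SelfSimilar.const_of_exponents (q := q) hg (by positivity) ((div_lt_one h₂).2 h₁₂)
      (by positivity) (by positivity) ?_ H₁₂ (by positivity) ((div_lt_one h₃).2 h₂₃) ?_ H₂₃ x y
    · rw [div_mul_eq_mul_div, div_le_one (by positivity), mul_comm]
      rw [lt_div_iff₀ (by positivity)] at e1
      exact e1.le
    · rw [show c₂ / c₃ = (c₃ / c₂)⁻¹ by rw [inv_div], Real.inv_rpow (by positivity),
        ← div_eq_mul_inv, one_lt_div (by positivity)]
      exact e2

/-! ### Planar recession cones -/

/-- `y / b` bounds the slopes of `g` in direction `b`: the recession cone of the epigraph. -/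
def SlopeBound (g : ℝ → ℝ) (b y : ℝ) : Prop :=
  ∀ x t : ℝ, 0 ≤ t → g (x + t * b) ≤ g x + t * y

namespace SlopeBound

variable {g : ℝ → ℝ}

lemma mono {b y y' : ℝ} (h : SlopeBound g b y) (hy : y ≤ y') : SlopeBound g b y' :=
  fun x t ht => (h x t ht).trans (by gcongr)

lemma zero_left {y : ℝ} : SlopeBound g 0 y ↔ 0 ≤ y := by
  refine ⟨fun h => ?_, fun h x t ht => ?_⟩
  · simpa using h 0 1 zero_le_one
  · simpa using mul_nonneg ht h

lemma mul_iff {r b y : ℝ} (hr : 0 < r) : SlopeBound g (r * b) (r * y) ↔ SlopeBound g b y := by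
  constructor
  · intro h x t ht
    have := h x (t / r) (by positivity)
    rwa [show t / r * (r * b) = t * b by field_simp,
      show t / r * (r * y) = t * y by field_simp] at this
  · intro h x t ht
    have := h x (t * r) (by positivity)
    rwa [mul_assoc, mul_assoc] at this

lemma exists_min {b : ℝ} (h : ∃ y, SlopeBound g b y) :
    ∃ m, ∀ y, SlopeBound g b y ↔ m ≤ y := by
  have hcl : IsClosed {y | SlopeBound g b y} := by
    simp only [SlopeBound, Set.ofPred_forall]
    refine isClosed_iInter fun x => isClosed_iInter fun t => isClosed_iInter fun _ => ?_
    exact isClosed_le (by fun_prop) (by fun_prop)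
  have hbd : BddBelow {y | SlopeBound g b y} := by
    refine ⟨g b - g 0, fun y hy => ?_⟩
    have := hy 0 1 zero_le_one
    simp at this
    linarith
  have hmem := hcl.csInf_mem h hbd
  exact ⟨_, fun y => ⟨fun hy => csInf_le hbd hy, fun hy => mono hmem hy⟩⟩

/-- When the slopes are bounded above and below, the cone of slope bounds is the intersection of
two half-planes. -/
lemma iff_of_min {P N : ℝ} (hP : ∀ y, SlopeBound g 1 y ↔ P ≤ y)
    (hN : ∀ y, SlopeBound g (-1) y ↔ N ≤ y) (b y : ℝ) :
    SlopeBound g b y ↔ b * P ≤ y ∧ -b * N ≤ y := by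
  have hPN : 0 ≤ P + N := by
    have h1 := (hP P).2 le_rfl 0 1 zero_le_one
    have h2 := (hN N).2 le_rfl 1 1 zero_le_one
    norm_num at h1 h2
    linarith
  rcases lt_trichotomy b 0 with hb | rfl | hb
  · have e : SlopeBound g b y ↔ SlopeBound g (-1) (y / -b) := by
      rw [← mul_iff (neg_pos.2 hb) (b := -1)]
      have := hb.ne
      rw [show -b * -1 = b by ring, show -b * (y / -b) = y by field_simp]
    rw [e, hN, le_div_iff₀ (neg_pos.2 hb)]
    refine ⟨fun h => ⟨?_, by linarith⟩, fun h => by linarith [h.2]⟩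
    nlinarith
  · simp [zero_left]
  · have e : SlopeBound g b y ↔ SlopeBound g 1 (y / b) := by
      rw [← mul_iff hb (b := 1)]
      rw [mul_one, show b * (y / b) = y by field_simp]
    rw [e, hP, le_div_iff₀ hb]
    refine ⟨fun h => ⟨by linarith, ?_⟩, fun h => by linarith [h.1]⟩
    nlinarith

end SlopeBound

/-! ### Planar congruences -/

/-- The plane isometry `(b, y) ↦ (σ (αb - ηβy) + τ₁, σ (βb + ηαy) + τ₂)` carries the graph of
`g / k` to the graph of `g (c ·) / k'`, and its linear part respects the recession cones. -/
structure PlanarCongruence (g : ℝ → ℝ) (k k' c α β η σ τ₁ τ₂ : ℝ) : Prop where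
  norm : α ^ 2 + β ^ 2 = 1
  det : η = 1 ∨ η = -1
  sign : σ = 1 ∨ σ = -1
  graph_iff : ∀ b y, k * y = g b ↔
    k' * (σ * (β * b + η * α * y) + τ₂) = g (c * (σ * (α * b - η * β * y) + τ₁))
  cone_iff : ∀ b y, SlopeBound g b (k * y) ↔
    SlopeBound g (c * (α * b - η * β * y)) (k' * (β * b + η * α * y))

/-- The vector (β, ηα) is the preimage of the vertical direction under the linear part. If two
congruences agree on it, one composed with the inverse of the other acts on abscissa and height
separately, each by a sign and a shift. -/
lemma PlanarCongruence.selfSimilar {g : ℝ → ℝ}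
    {k k₁ k₂ c₁ c₂ α₁ β₁ η₁ σ₁ τ₁ τ₁' α₂ β₂ η₂ σ₂ τ₂ τ₂' : ℝ}
    (C₁ : PlanarCongruence g k k₁ c₁ α₁ β₁ η₁ σ₁ τ₁ τ₁')
    (C₂ : PlanarCongruence g k k₂ c₂ α₂ β₂ η₂ σ₂ τ₂ τ₂')
    (hk₁ : 0 < k₁) (hk₂ : 0 < k₂) (hc₁ : 0 < c₁)
    (hβ : β₁ = β₂) (hα : η₁ * α₁ = η₂ * α₂) : SelfSimilar g (k₁ / k₂) (c₂ / c₁) := by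
  -- The point (βY + ηαB, ηαY − βB) is the one sent to (ηB, Y) by the linear part. It depends on the
  -- congruence only through β and ηα.
  have key : ∀ {k' c α β η σ τ τ' : ℝ}, PlanarCongruence g k k' c α β η σ τ τ' →
      ∀ B Y, k * (η * α * Y - β * B) = g (β * Y + η * α * B) ↔
        k' * (σ * Y + τ') = g (c * (σ * η * B + τ)) := by
    intro k' c α β η σ τ τ' C B Y
    rw [C.graph_iff]
    have h2 : η * η = 1 := by rcases C.det with h | h <;> rw [h] <;> norm_num
    have e1 : β * (β * Y + η * α * B) + η * α * (η * α * Y - β * B) = Y := by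
      linear_combination Y * C.norm + α ^ 2 * Y * h2
    have e2 : α * (β * Y + η * α * B) - η * β * (η * α * Y - β * B) = η * B := by
      linear_combination η * B * C.norm - α * β * Y * h2
    rw [e1, e2, mul_assoc σ η B]
  have h : ∀ B Y, k₁ * (σ₁ * Y + τ₁') = g (c₁ * (σ₁ * η₁ * B + τ₁)) ↔
      k₂ * (σ₂ * Y + τ₂') = g (c₂ * (σ₂ * η₂ * B + τ₂)) := by
    intro B Y
    rw [← key C₁, ← key C₂, hβ, hα]
  have hs₁ : σ₁ * σ₁ = 1 := by rcases C₁.sign with h | h <;> rw [h] <;> norm_num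
  have hη₁ : η₁ * η₁ = 1 := by rcases C₁.det with h | h <;> rw [h] <;> norm_num
  have hs₂ : |σ₂| = 1 := by rcases C₂.sign with h | h <;> rw [h] <;> norm_num
  have hs₁' : |σ₁| = 1 := by rcases C₁.sign with h | h <;> rw [h] <;> norm_num
  have h' : ∀ B, g (c₂ * (σ₂ * η₂ * B + τ₂)) =
      k₂ * (σ₂ * (σ₁ * (g (c₁ * (σ₁ * η₁ * B + τ₁)) / k₁ - τ₁')) + τ₂') := by
    intro B
    refine ((h B _).1 ?_).symm
    rw [← mul_assoc, hs₁]
    field_simp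
    ring
  refine ⟨σ₂ * η₂ * (σ₁ * η₁), c₂ * (τ₂ - σ₂ * η₂ * (σ₁ * η₁) * τ₁), ?_, fun x y => ?_⟩
  · rcases C₁.sign with h | h <;> rcases C₂.sign with h' | h' <;> rcases C₁.det with h'' | h'' <;>
      rcases C₂.det with h''' | h''' <;> rw [h, h', h'', h'''] <;> norm_num
  · have e : ∀ x, g (σ₂ * η₂ * (σ₁ * η₁) * (c₂ / c₁) * x + c₂ * (τ₂ - σ₂ * η₂ * (σ₁ * η₁) * τ₁)) =
        k₂ * (σ₂ * (σ₁ * (g x / k₁ - τ₁')) + τ₂') := by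
      intro x
      have := h' (σ₁ * η₁ * (x / c₁ - τ₁))
      rw [show c₁ * (σ₁ * η₁ * (σ₁ * η₁ * (x / c₁ - τ₁)) + τ₁) = x by
        rw [show σ₁ * η₁ * (σ₁ * η₁ * (x / c₁ - τ₁)) = (σ₁ * σ₁) * (η₁ * η₁) * (x / c₁ - τ₁) by ring,
          hs₁, hη₁]; field_simp; ring] at this
      rw [← this]
      congr 1
      ring
    rw [e, e, show k₂ * (σ₂ * (σ₁ * (g x / k₁ - τ₁')) + τ₂') -
      k₂ * (σ₂ * (σ₁ * (g y / k₁ - τ₁')) + τ₂') = k₂ / k₁ * σ₂ * σ₁ * (g x - g y) by ring,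
      abs_mul, abs_mul, abs_mul, hs₂, hs₁', abs_of_pos (by positivity : 0 < k₂ / k₁)]
    field_simp

/-- If the slopes are unbounded in direction `e`, the vertical direction is an extreme ray of both
recession cones, which determines the congruence up to two possibilities. -/
lemma PlanarCongruence.direction {g : ℝ → ℝ} {k k' c α β η σ τ₁ τ₂ e : ℝ} (hk : 0 < k)
    (hk' : 0 < k') (hc : 0 < c) (he : e = 1 ∨ e = -1) (hg : ∀ y, ¬ SlopeBound g e y)
    (C : PlanarCongruence g k k' c α β η σ τ₁ τ₂) :
    (β = 0 ∧ η * α = 1) ∨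
      (0 < -e * β ∧ ∀ y, SlopeBound g β y ↔ k * (η * α) ≤ y) := by
  have hη : η * η = 1 := by rcases C.det with h | h <;> rw [h] <;> norm_num
  have hee : e * e = 1 := by rcases he with h | h <;> rw [h] <;> norm_num
  have hneg : ∀ b y, SlopeBound g b y → e * b ≤ 0 := by
    intro b y h
    by_contra! hb
    refine hg (y / (e * b)) ?_
    rw [← SlopeBound.mul_iff hb]
    rwa [show e * b * e = b by linear_combination b * hee, mul_div_cancel₀ _ hb.ne']
  have hmem : SlopeBound g β (k * (η * α)) := by
    rw [C.cone_iff]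
    rw [show c * (α * β - η * β * (η * α)) = 0 by linear_combination -c * α * β * hη,
      show β * β + η * α * (η * α) = 1 by linear_combination C.norm + α ^ 2 * hη,
      SlopeBound.zero_left]
    linarith
  rcases eq_or_ne β 0 with hβ | hβ
  · left
    refine ⟨hβ, ?_⟩
    rw [hβ, SlopeBound.zero_left] at hmem
    have h1 : (η * α - 1) * (η * α + 1) = 0 := by
      have := C.norm
      rw [hβ] at this
      linear_combination this + α ^ 2 * hη
    rcases mul_eq_zero.1 h1 with h | h
    · linarith
    · nlinarith [nonneg_of_mul_nonneg_right hmem hk]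
  · right
    have hle := hneg _ _ hmem
    have hne : e * β ≠ 0 := mul_ne_zero (fun h => by simp [h] at hee) hβ
    refine ⟨by have := lt_of_le_of_ne hle hne; linarith, fun y => ⟨fun hy => ?_, hmem.mono⟩⟩
    by_contra! hlt
    obtain ⟨z, rfl⟩ : ∃ z, y = k * z := ⟨y / k, by field_simp⟩
    have ht : 0 < η * α - z := by
      have := lt_of_mul_lt_mul_left hlt hk.le
      linarith
    -- The vectors (β, z) and (0, ηα − z) add up to the preimage of the vertical, so their images
    -- have opposite horizontal components. Both images lie on the same side, hence both components
    -- vanish.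
    have h1 := hneg _ _ ((C.cone_iff _ _).1 hy)
    have h2 := hneg _ _ ((C.cone_iff 0 (η * α - z)).1
      (SlopeBound.zero_left.2 (by positivity)))
    have e1 : e * (c * (α * β - η * β * z)) = e * β * η * c * (η * α - z) := by
      linear_combination -e * c * α * β * hη
    have e2 : e * (c * (α * 0 - η * β * (η * α - z))) = -(e * β * η * c * (η * α - z)) := by ring
    have h3 : e * β * η * c * (η * α - z) = 0 := by linarith
    have hη0 : η ≠ 0 := fun h => by simp [h] at hη
    exact absurd h3 (by simp [hne, hη0, hc.ne', ht.ne'] : e * β * η * c * (η * α - z) ≠ 0)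

/-- On the side of −e the cone has a single lower boundary ray, and both pairs are unit vectors on
it. -/
lemma PlanarCongruence.direction_unique {g : ℝ → ℝ}
    {k k₁ k₂ c₁ c₂ α₁ β₁ η₁ σ₁ τ₁ τ₁' α₂ β₂ η₂ σ₂ τ₂ τ₂' e : ℝ}
    (C₁ : PlanarCongruence g k k₁ c₁ α₁ β₁ η₁ σ₁ τ₁ τ₁')
    (C₂ : PlanarCongruence g k k₂ c₂ α₂ β₂ η₂ σ₂ τ₂ τ₂')
    (hk : 0 < k) (he : e = 1 ∨ e = -1)
    (h₁ : 0 < -e * β₁ ∧ ∀ y, SlopeBound g β₁ y ↔ k * (η₁ * α₁) ≤ y)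
    (h₂ : 0 < -e * β₂ ∧ ∀ y, SlopeBound g β₂ y ↔ k * (η₂ * α₂) ≤ y) :
    β₁ = β₂ ∧ η₁ * α₁ = η₂ * α₂ := by
  have hη₁ : η₁ * η₁ = 1 := by rcases C₁.det with h | h <;> rw [h] <;> norm_num
  have hη₂ : η₂ * η₂ = 1 := by rcases C₂.det with h | h <;> rw [h] <;> norm_num
  have hee : e * e = 1 := by rcases he with h | h <;> rw [h] <;> norm_num
  have n₁ : (η₁ * α₁) ^ 2 + (-e * β₁) ^ 2 = 1 := by
    linear_combination C₁.norm + α₁ ^ 2 * hη₁ + β₁ ^ 2 * hee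
  have n₂ : (η₂ * α₂) ^ 2 + (-e * β₂) ^ 2 = 1 := by
    linear_combination C₂.norm + α₂ ^ 2 * hη₂ + β₂ ^ 2 * hee
  have b₁ : β₁ = -e * β₁ * -e := by linear_combination -β₁ * hee
  have b₂ : β₂ = -e * β₂ * -e := by linear_combination -β₂ * hee
  obtain ⟨r₁, H₁⟩ := h₁
  obtain ⟨r₂, H₂⟩ := h₂
  set x₁ := -e * β₁
  set x₂ := -e * β₂
  set d₁ := η₁ * α₁
  set d₂ := η₂ * α₂
  have H : ∀ z, k * d₁ ≤ x₁ * z ↔ k * d₂ ≤ x₂ * z := by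
    intro z
    rw [← H₁, ← H₂, b₁, b₂, SlopeBound.mul_iff r₁, SlopeBound.mul_iff r₂]
  have i1 := (H (k * d₁ / x₁)).1 (by rw [mul_div_cancel₀ _ r₁.ne'])
  have i2 := (H (k * d₂ / x₂)).2 (by rw [mul_div_cancel₀ _ r₂.ne'])
  rw [mul_div_assoc', le_div_iff₀ r₁] at i1
  rw [mul_div_assoc', le_div_iff₀ r₂] at i2
  have hd : d₁ * x₂ = d₂ * x₁ := by
    refine mul_left_cancel₀ hk.ne' ?_
    linarith
  have hx : (x₁ - x₂) * (x₁ + x₂) = 0 := by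
    linear_combination x₂ ^ 2 * n₁ - x₁ ^ 2 * n₂ - (d₁ * x₂ + d₂ * x₁) * hd
  have hx' : x₁ = x₂ := by
    rcases mul_eq_zero.1 hx with h | h <;> linarith
  refine ⟨by rw [b₁, b₂, hx'], ?_⟩
  rw [hx'] at hd
  exact mul_right_cancel₀ r₂.ne' hd

/-- Linear isometries between planar cones preserve the angle. -/
lemma angle_eq {p n μ α β η : ℝ} (hpn : 0 < p + n) (hμ : 0 < μ) (hαβ : α ^ 2 + β ^ 2 = 1)
    (hη : η = 1 ∨ η = -1)
    (h : ∀ b y, (b * p ≤ y ∧ -b * n ≤ y) ↔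
      (μ * (α * b - η * β * y) * p ≤ β * b + η * α * y ∧
        -(μ * (α * b - η * β * y)) * n ≤ β * b + η * α * y)) :
    (μ - 1) * (p * n * μ + 1) = 0 := by
  have hηη : η * η = 1 := by rcases hη with h | h <;> rw [h] <;> norm_num
  -- Boundary goes to boundary: if the image satisfied both inequalities strictly, the point could
  -- be lowered slightly without leaving the cone.
  have bd : ∀ b y, (b * p ≤ y ∧ -b * n ≤ y) → (∀ ε, 0 < ε → ¬(b * p ≤ y - ε ∧ -b * n ≤ y - ε)) →
      (β * b + η * α * y = μ * (α * b - η * β * y) * p ∧ 0 ≤ α * b - η * β * y) ∨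
      (β * b + η * α * y = -(μ * (α * b - η * β * y)) * n ∧ α * b - η * β * y ≤ 0) := by
    intro b y hy hmin
    obtain ⟨g1, g2⟩ := (h b y).1 hy
    have hmin' : ∀ ε : ℝ, 0 < ε → _ := fun ε hε H => hmin ε hε ((h b (y - ε)).2 H)
    set b' := α * b - η * β * y
    set y' := β * b + η * α * y
    rcases g1.eq_or_lt with g1 | g1
    · left
      refine ⟨g1.symm, ?_⟩
      by_contra! hb
      nlinarith [mul_neg_of_pos_of_neg (mul_pos hμ hpn) hb]
    · rcases g2.eq_or_lt with g2 | g2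
      · right
        refine ⟨g2.symm, ?_⟩
        by_contra! hb
        nlinarith [mul_pos (mul_pos hμ hpn) hb]
      · exfalso
        set K₁ := μ * η * β * p + η * α
        set K₂ := -(μ * η * β) * n + η * α
        set m := min (y' - μ * b' * p) (y' - -(μ * b') * n) with hm
        have hm0 : 0 < m := lt_min (by linarith) (by linarith)
        have hK : 0 < |K₁| + |K₂| + 1 := by positivity
        refine hmin' (m / (|K₁| + |K₂| + 1)) (by positivity) ?_
        set ε := m / (|K₁| + |K₂| + 1) with hε
        have hε0 : 0 < ε := by positivity
        have hεm : ε * (|K₁| + |K₂| + 1) = m := by rw [hε]; field_simp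
        have j1 : ε * K₁ ≤ m := by
          rw [← hεm]; gcongr; linarith [le_abs_self K₁, abs_nonneg K₂]
        have j2 : ε * K₂ ≤ m := by
          rw [← hεm]; gcongr; linarith [le_abs_self K₂, abs_nonneg K₁]
        have j3 := min_le_left (y' - μ * b' * p) (y' - -(μ * b') * n)
        have j4 := min_le_right (y' - μ * b' * p) (y' - -(μ * b') * n)
        rw [← hm] at j3 j4
        constructor
        · have : μ * (α * b - η * β * (y - ε)) * p - (β * b + η * α * (y - ε)) =
            μ * b' * p - y' + ε * K₁ := by ring
          linarith
        · have : -(μ * (α * b - η * β * (y - ε))) * n - (β * b + η * α * (y - ε)) =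
            -(μ * b') * n - y' + ε * K₂ := by ring
          linarith
  -- For the boundary vectors (1, p) and (−1, n), the isometry keeps the inner product pn − 1 and
  -- multiplies the cross product p + n by η. The images lie on the rays of slopes μp and −μn, and
  -- comparing the two quantities there gives the equation.
  have hcross : (α * 1 - η * β * p) * (β * (-1) + η * α * n) -
      (β * 1 + η * α * p) * (α * (-1) - η * β * n) = η * (p + n) := by
    linear_combination η * (p + n) * hαβ
  have hdot : (α * 1 - η * β * p) * (α * (-1) - η * β * n) +
      (β * 1 + η * α * p) * (β * (-1) + η * α * n) = p * n - 1 := by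
    linear_combination (p * n - 1) * hαβ + p * n * (α ^ 2 + β ^ 2) * hηη
  have h1 := bd 1 p ⟨by linarith, by linarith⟩ (fun ε hε H => by linarith [H.1])
  have h2 := bd (-1) n ⟨by linarith, by linarith⟩ (fun ε hε H => by linarith [H.2])
  set x₁ := α * 1 - η * β * p
  set y₁ := β * 1 + η * α * p
  set x₂ := α * (-1) - η * β * n
  set y₂ := β * (-1) + η * α * n
  have hηne : η * (p + n) ≠ 0 :=
    mul_ne_zero (by rcases hη with h | h <;> rw [h] <;> norm_num) hpn.ne'
  rcases h1 with ⟨h1, s1⟩ | ⟨h1, s1⟩ <;> rcases h2 with ⟨h2, s2⟩ | ⟨h2, s2⟩ <;>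
    rw [h1, h2] at hcross hdot
  · exact absurd (by rw [← hcross]; ring) hηne
  · have e : -(μ * (x₁ * x₂)) = η := mul_right_cancel₀ hpn.ne' (by linear_combination hcross)
    rcases hη with h | h
    · rw [h] at e
      linear_combination μ * hdot + (1 - μ ^ 2 * p * n) * e
    · rw [h] at e
      nlinarith [mul_nonneg hμ.le (mul_nonneg s1 (neg_nonneg.2 s2))]
  · have e : μ * (x₁ * x₂) = η := mul_right_cancel₀ hpn.ne' (by linear_combination hcross)
    rcases hη with h | h
    · rw [h] at e
      nlinarith [mul_nonneg hμ.le (mul_nonneg (neg_nonneg.2 s1) s2)]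
    · rw [h] at e
      linear_combination μ * hdot - (1 - μ ^ 2 * p * n) * e
  · exact absurd (by rw [← hcross]; ring) hηne

lemma const_of_frequently_selfSimilar {g : ℝ → ℝ} (hg : Continuous g) {s : ℝ} {p : ℝ → Prop}
    (hp : ∃ᶠ c in atTop, p c)
    (h : ∀ c c', 0 < c → 0 < c' → p c → p c' →
      SelfSimilar g (√(1 + s ^ 2 * c ^ 2) / √(1 + s ^ 2 * c' ^ 2)) (c' / c)) (x y : ℝ) :
    g x = g y := by
  obtain ⟨c₁, h₁, p₁⟩ := (frequently_atTop.1 hp) 1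
  obtain ⟨c₂, h₂, p₂⟩ := (frequently_atTop.1 hp) (c₁ + 1)
  obtain ⟨c₃, h₃, p₃⟩ := (frequently_atTop.1 hp) (c₂ + 1)
  exact const_of_three_selfSimilar hg (c₁ := c₁) (c₂ := c₂) (c₃ := c₃) (by linarith) (by linarith)
    (by linarith) (h c₂ c₁ (by linarith) (by linarith) p₂ p₁)
    (h c₃ c₂ (by linarith) (by linarith) p₃ p₂) x y

/-- The stretching factor `c √(1 + s²) / √(1 + s² c²)` is injective. -/
lemma stretch_injective {s c c' : ℝ} (hc : 0 < c) (hc' : 0 < c')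
    (h : c * √(1 + s ^ 2) / √(1 + s ^ 2 * c ^ 2) = c' * √(1 + s ^ 2) / √(1 + s ^ 2 * c' ^ 2)) :
    c = c' := by
  have h1 : 0 < √(1 + s ^ 2) := by positivity
  rw [div_eq_div_iff (by positivity) (by positivity)] at h
  have h2 : c * √(1 + s ^ 2 * c' ^ 2) = c' * √(1 + s ^ 2 * c ^ 2) :=
    mul_left_cancel₀ h1.ne' (by linear_combination h)
  have h3 : c ^ 2 * (1 + s ^ 2 * c' ^ 2) = c' ^ 2 * (1 + s ^ 2 * c ^ 2) := by
    have h5 := congrArg (· ^ 2) h2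
    simp only [mul_pow] at h5
    rwa [Real.sq_sqrt (by positivity), Real.sq_sqrt (by positivity)] at h5
  have h4 : c ^ 2 = c' ^ 2 := by linear_combination h3
  nlinarith

theorem affine_of_planarCongruence {g : ℝ → ℝ} (hg : Continuous g) {s : ℝ}
    (h : ∃ᶠ c in atTop, ∃ α β η σ τ₁ τ₂,
      PlanarCongruence g (√(1 + s ^ 2)) (√(1 + s ^ 2 * c ^ 2)) c α β η σ τ₁ τ₂) :
    ∃ m, ∀ x t, g (x + t) = g x + t * m := by
  have hk : 0 < √(1 + s ^ 2) := by positivity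
  have hk' : ∀ c, 0 < √(1 + s ^ 2 * c ^ 2) := fun c => by positivity
  by_cases hb : ∃ e, (e = 1 ∨ e = -1) ∧ ∀ y, ¬ SlopeBound g e y
  · obtain ⟨e, he, hne⟩ := hb
    refine ⟨0, fun x t => ?_⟩
    rw [mul_zero, add_zero]
    have h' : ∃ᶠ c in atTop,
        (∃ α β η σ τ₁ τ₂, PlanarCongruence g (√(1 + s ^ 2)) (√(1 + s ^ 2 * c ^ 2)) c α β η σ τ₁ τ₂ ∧
          (β = 0 ∧ η * α = 1)) ∨
        (∃ α β η σ τ₁ τ₂, PlanarCongruence g (√(1 + s ^ 2)) (√(1 + s ^ 2 * c ^ 2)) c α β η σ τ₁ τ₂ ∧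
          (0 < -e * β ∧ ∀ y, SlopeBound g β y ↔ √(1 + s ^ 2) * (η * α) ≤ y)) := by
      refine (h.and_eventually (eventually_gt_atTop 0)).mono ?_
      rintro c ⟨⟨α, β, η, σ, τ₁, τ₂, C⟩, hc⟩
      rcases C.direction hk (hk' c) hc he hne with H | H
      · exact Or.inl ⟨α, β, η, σ, τ₁, τ₂, C, H⟩
      · exact Or.inr ⟨α, β, η, σ, τ₁, τ₂, C, H⟩
    -- One of the two directions recurs for arbitrarily large c, and any two congruences with that
    -- direction are comparable.
    rcases frequently_or_distrib.1 h' with h' | h'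
    · refine const_of_frequently_selfSimilar hg (s := s) h' ?_ _ _
      rintro c c' hc hc' ⟨α, β, η, σ, τ₁, τ₂, C, hβ, hα⟩ ⟨α', β', η', σ', τ₁', τ₂', C', hβ', hα'⟩
      exact C.selfSimilar C' (hk' c) (hk' c') hc (by rw [hβ, hβ']) (by rw [hα, hα'])
    · refine const_of_frequently_selfSimilar hg (s := s) h' ?_ _ _
      rintro c c' hc hc' ⟨α, β, η, σ, τ₁, τ₂, C, H⟩ ⟨α', β', η', σ', τ₁', τ₂', C', H'⟩
      obtain ⟨hβ, hα⟩ := C.direction_unique C' hk he H H'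
      exact C.selfSimilar C' (hk' c) (hk' c') hc hβ hα
  · push Not at hb
    obtain ⟨P, hP⟩ := SlopeBound.exists_min (hb 1 (Or.inl rfl))
    obtain ⟨N, hN⟩ := SlopeBound.exists_min (hb (-1) (Or.inr rfl))
    have hR := SlopeBound.iff_of_min hP hN
    -- If P + N ≤ 0, the upper and lower slope bounds meet and every slope equals P.
    rcases le_or_gt (P + N) 0 with hPN | hPN
    · have hP' := (hP P).2 le_rfl
      have hN' := (hN (-P)).2 (by linarith)
      refine ⟨P, fun x t => ?_⟩
      have main : ∀ x t, 0 ≤ t → g (x + t) = g x + t * P := by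
        intro x t ht
        have h1 := hP' x t ht
        have h2 := hN' (x + t) t ht
        rw [mul_one] at h1
        rw [show x + t + t * -1 = x by ring] at h2
        linarith
      rcases le_total 0 t with ht | ht
      · exact main x t ht
      · have := main (x + t) (-t) (by linarith)
        rw [add_neg_cancel_right] at this
        linarith
    · exfalso
      set k := √(1 + s ^ 2)
      have key : ∀ c, 1 < c → (∃ α β η σ τ₁ τ₂,
          PlanarCongruence g k (√(1 + s ^ 2 * c ^ 2)) c α β η σ τ₁ τ₂) →
          P / k * (N / k) * (c * k / √(1 + s ^ 2 * c ^ 2)) = -1 := by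
        rintro c hc ⟨α, β, η, σ, τ₁, τ₂, C⟩
        have hc0 : 0 < c := by linarith
        have hkc := hk' c
        have := angle_eq (p := P / k) (n := N / k) (μ := c * k / √(1 + s ^ 2 * c ^ 2))
          (by rw [← add_div]; positivity) (by positivity) C.norm C.det (fun b y => by
            have hC := C.cone_iff b y
            rw [hR, hR] at hC
            set b' := α * b - η * β * y
            set y' := β * b + η * α * y
            have e1 : b * (P / k) ≤ y ↔ b * P ≤ k * y := by
              rw [mul_div_assoc', div_le_iff₀ hk, mul_comm y]
            have e2 : -b * (N / k) ≤ y ↔ -b * N ≤ k * y := by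
              rw [mul_div_assoc', div_le_iff₀ hk, mul_comm y]
            have e3 : c * k / √(1 + s ^ 2 * c ^ 2) * b' * (P / k) ≤ y' ↔
                c * b' * P ≤ √(1 + s ^ 2 * c ^ 2) * y' := by
              rw [show c * k / √(1 + s ^ 2 * c ^ 2) * b' * (P / k) =
                c * b' * P / √(1 + s ^ 2 * c ^ 2) by field_simp, div_le_iff₀ hkc, mul_comm y']
            have e4 : -(c * k / √(1 + s ^ 2 * c ^ 2) * b') * (N / k) ≤ y' ↔
                -(c * b') * N ≤ √(1 + s ^ 2 * c ^ 2) * y' := by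
              rw [show -(c * k / √(1 + s ^ 2 * c ^ 2) * b') * (N / k) =
                -(c * b') * N / √(1 + s ^ 2 * c ^ 2) by field_simp, div_le_iff₀ hkc, mul_comm y']
            rw [e1, e2, e3, e4]
            exact hC)
        rcases mul_eq_zero.1 this with h | h
        · exfalso
          refine hc.ne' (stretch_injective (s := s) hc0 one_pos ?_)
          rw [sub_eq_zero.1 h, one_pow, mul_one, one_mul]
          exact (div_self hk.ne').symm
        · linarith
      -- The equation in `key` determines the stretching factor, hence c, so two values of c
      -- contradict each other.
      obtain ⟨c₁, h₁, p₁⟩ := (frequently_atTop.1 h) 2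
      obtain ⟨c₂, h₂, p₂⟩ := (frequently_atTop.1 h) (c₁ + 1)
      have k₁ := key c₁ (by linarith) p₁
      have k₂ := key c₂ (by linarith) p₂
      have hne : P / k * (N / k) ≠ 0 := fun h => by rw [h] at k₁; norm_num at k₁
      have := stretch_injective (s := s) (by linarith) (by linarith)
        (mul_left_cancel₀ hne (k₁.trans k₂.symm))
      linarith

/-! ### Congruences with a common vertical axis -/

lemma pt_eq_add (x : Plane) (z : ℝ) : pt x z = pt x 0 + z • vert :=
  space_ext (by simp) (by simp)

lemma norm_pt_zero (x : Plane) : ‖pt x 0‖ = ‖x‖ := by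
  have := space_norm_sq (pt x 0)
  simp only [hor_pt, pt_apply_two] at this
  rw [← abs_of_nonneg (norm_nonneg (pt x 0)), ← abs_of_nonneg (norm_nonneg x), ← sq_eq_sq_iff_abs_eq_abs]
  linarith

/-- If two congruences to different dilates have the same vertical direction, then the function
is constant. -/
lemma const_of_axis_of_lt {f : Plane → ℝ} (hf : Continuous f) {c c' : ℝ} (hc' : 0 < c')
    (hlt : c' < c) {Q Q' : Space ≃ₗᵢ[ℝ] Space} {σ σ' e : ℝ} {τ τ' : Space}
    (C : Congruence f (fun x => f (c • x)) Q σ τ) (C' : Congruence f (fun x => f (c' • x)) Q' σ' τ')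
    (he : e = 1 ∨ e = -1) (h : Q'.symm vert = e • Q.symm vert) (x y : Plane) : f x = f y := by
  have hc : 0 < c := hc'.trans hlt
  have hσ : σ * σ = 1 := by rcases C.sign with h | h <;> rw [h] <;> norm_num
  have hσσ' : |σ| = 1 := by rcases C.sign with h | h <;> rw [h] <;> norm_num
  have hσ' : |σ'| = 1 := by rcases C'.sign with h | h <;> rw [h] <;> norm_num
  have hee : e * e = 1 := by rcases he with h | h <;> rw [h] <;> norm_num
  have hea : |e| = 1 := by rcases he with h | h <;> rw [h] <;> norm_num
  set R : Space ≃ₗᵢ[ℝ] Space := Q.symm.trans Q' with hR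
  have hRv : R vert = e • vert := by
    have : Q.symm vert = e • Q'.symm vert := by rw [h, smul_smul, hee, one_smul]
    simp [hR, this]
  have hR2 : ∀ p, (R p) 2 = e * p 2 := by
    intro p
    have : vert = e • R vert := by rw [hRv, smul_smul, hee, one_smul]
    rw [← inner_vert, this, real_inner_smul_right, R.inner_map_map, inner_vert]
  -- S is the horizontal shadow of the passage from the graph of f(c ·) to that of f(c' ·). Since R
  -- preserves the vertical axis, heights do not influence it, and its ratio is c' / c.
  set S : Plane → Plane := fun x => c' • ((σ' * σ) • hor (R (pt (c⁻¹ • x) 0 - τ)) + hor τ') with hS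
  have hfS : ∀ x, f (S x) = σ' * σ * (e * (f x - τ 2)) + τ' 2 := by
    intro x
    set p := Q.symm (σ • (pt (c⁻¹ • x) (f x) - τ)) with hp
    have h1 : σ • Q p + τ = pt (c⁻¹ • x) (f x) := by
      rw [hp, Q.apply_symm_apply, smul_smul, hσ, one_smul, sub_add_cancel]
    have h2 : p 2 = f (hor p) := by
      rw [C.graph_iff, h1]
      simp [smul_smul, hc.ne']
    rw [C'.graph_iff] at h2
    have h3 : Q' p = σ • R (pt (c⁻¹ • x) (f x) - τ) := by
      rw [hp, map_smul, map_smul]; rfl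
    rw [h3, smul_smul] at h2
    have h4 : hor (R (pt (c⁻¹ • x) (f x) - τ)) = hor (R (pt (c⁻¹ • x) 0 - τ)) := by
      rw [pt_eq_add, add_sub_right_comm, map_add R, map_smul R, hRv]
      simp
    simp only [map_add hor, map_smul hor, h4] at h2
    rw [show S x = c' • ((σ' * σ) • hor (R (pt (c⁻¹ • x) 0 - τ)) + hor τ') from rfl, ← h2]
    simp only [PiLp.add_apply, PiLp.smul_apply, PiLp.sub_apply, hR2, smul_eq_mul, pt_apply_two]
  have hSc : ContractingWith ⟨c' / c, by positivity⟩ S := by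
    refine ⟨by exact_mod_cast (div_lt_one hc).2 hlt, LipschitzWith.of_dist_le_mul fun x y => ?_⟩
    rw [dist_eq_norm, dist_eq_norm]
    have e1 : S x - S y = (c' * (σ' * σ)) • hor (R (pt (c⁻¹ • (x - y)) 0)) := by
      have : pt (c⁻¹ • (x - y)) 0 = (pt (c⁻¹ • x) 0 - τ) - (pt (c⁻¹ • y) 0 - τ) :=
        space_ext (by simp [smul_sub]) (by simp)
      rw [this, map_sub R, map_sub hor, smul_sub]
      simp only [hS, smul_add, smul_smul]
      abel
    rw [e1, norm_smul, Real.norm_eq_abs, abs_mul, abs_mul, hσ', hσσ', abs_of_pos hc', mul_one,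
      mul_one]
    calc c' * ‖hor (R (pt (c⁻¹ • (x - y)) 0))‖ ≤ c' * ‖R (pt (c⁻¹ • (x - y)) 0)‖ := by
          gcongr; exact norm_hor_le _
      _ = c' * (c⁻¹ * ‖x - y‖) := by
          rw [R.norm_map, norm_pt_zero, norm_smul, Real.norm_eq_abs, abs_of_pos (by positivity)]
      _ = c' / c * ‖x - y‖ := by ring
  refine const_of_contracting hf hSc (fun x y => ?_) x y
  rw [hfS, hfS, show σ' * σ * (e * (f x - τ 2)) + τ' 2 - (σ' * σ * (e * (f y - τ 2)) + τ' 2) =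
    σ' * σ * e * (f x - f y) by ring, abs_mul, abs_mul, abs_mul, hσ', hσσ', hea]
  simp

lemma const_of_axis {f : Plane → ℝ} (hf : Continuous f) {c c' : ℝ} (hc : 0 < c) (hc' : 0 < c')
    (hne : c' ≠ c) {Q Q' : Space ≃ₗᵢ[ℝ] Space} {σ σ' e : ℝ} {τ τ' : Space}
    (C : Congruence f (fun x => f (c • x)) Q σ τ) (C' : Congruence f (fun x => f (c' • x)) Q' σ' τ')
    (he : e = 1 ∨ e = -1) (h : Q'.symm vert = e • Q.symm vert) (x y : Plane) : f x = f y := by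
  rcases lt_or_gt_of_ne hne with hlt | hlt
  · exact const_of_axis_of_lt hf hc' hlt C C' he h x y
  · refine const_of_axis_of_lt hf hc hlt C' C he ?_ x y
    have hee : e * e = 1 := by rcases he with h | h <;> rw [h] <;> norm_num
    rw [h, smul_smul, hee, one_smul]

/-! ### Pointed recession cones -/

/-- A linear isometry mapping a closed set into itself maps it onto itself. -/
lemma symm_mem_of_mapsTo {V : Type*} [NormedAddCommGroup V] [NormedSpace ℝ V]
    [FiniteDimensional ℝ V] (Q : V ≃ₗᵢ[ℝ] V) {s : Set V} (hs : IsClosed s)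
    (h : ∀ w ∈ s, Q w ∈ s) {w : V} (hw : w ∈ s) : Q.symm w ∈ s := by
  have := FiniteDimensional.proper ℝ V
  have hmem : ∀ n : ℕ, Q^[n] w ∈ s := by
    intro n
    induction n with
    | zero => exact hw
    | succ n ih => rw [Function.iterate_succ_apply']; exact h _ ih
  have hiso : ∀ n : ℕ, Isometry Q^[n] := by
    intro n
    induction n with
    | zero => exact isometry_id
    | succ n ih => rw [Function.iterate_succ']; exact Q.isometry.comp ih
  have hball : ∀ n : ℕ, Q^[n] w ∈ Metric.closedBall (0 : V) ‖w‖ := by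
    intro n
    have := (hiso n).dist_eq w 0
    have h0 : Q^[n] 0 = 0 := Function.iterate_fixed (map_zero Q) n
    rw [h0, dist_zero_right w] at this
    rw [Metric.mem_closedBall, this]
  -- By compactness the orbit nearly returns: Q^m w and Q^(m+k+1) w are ε-close for some m, k.
  -- Undoing m + 1 steps puts Q^k w within ε of Q⁻¹w.
  obtain ⟨a, -, φ, hφ, hlim⟩ := (isCompact_closedBall (0 : V) ‖w‖).tendsto_subseq hball
  rw [← hs.closure_eq, Metric.mem_closure_iff]
  intro ε hε
  obtain ⟨N, hN⟩ := Metric.cauchySeq_iff.1 hlim.cauchySeq ε hε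
  have hd := hN N le_rfl (N + 1) (Nat.le_succ N)
  have hlt : φ N < φ (N + 1) := hφ (Nat.lt_succ_self N)
  obtain ⟨k, hk⟩ := Nat.exists_eq_add_of_lt hlt
  refine ⟨Q^[k] w, hmem k, ?_⟩
  rw [← (hiso (φ N + 1)).dist_eq, Function.iterate_succ_apply, Q.apply_symm_apply,
    ← Function.iterate_add_apply, show φ N + 1 + k = φ (N + 1) by omega]
  exact hd

/-- The recession cone contains no line. -/
def RecConePointed (f : Plane → ℝ) : Prop := ∀ w, w ∈ recCone f → -w ∈ recCone f → w = 0

/-- In a pointed recession cone of a rigid function no vector points below the horizontal. -/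
lemma height_nonneg {f : Plane → ℝ} (hf : Continuous f) (hp : RecConePointed f)
    (h : ∃ᶠ c : ℝ in atTop, ∃ Q σ τ, Congruence f (fun x => f (c • x)) Q σ τ) {w : Space}
    (hw : w ∈ recCone f) : 0 ≤ w 2 := by
  by_contra! hneg
  have hch : ∀ n : ℕ, ∃ c : ℝ, (n : ℝ) + 1 ≤ c ∧
      ∃ Q σ τ, Congruence f (fun x => f (c • x)) Q σ τ := fun n => (frequently_atTop.1 h) _
  choose c hc Q σ τ C using hch
  have hc0 : ∀ n, 0 < c n := fun n => by
    linarith [hc n, Nat.cast_nonneg (α := ℝ) n]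
  -- Dilation by c n tilts w towards straight down. After normalizing to height −1, its pullback `b
  -- n` is asymptotically opposite to `a n`, so a limit of the `a n` spans a line in the cone.
  set a : ℕ → Space := fun n => (Q n).symm vert with ha
  set b : ℕ → Space := fun n => (-w 2)⁻¹ • (Q n).symm (pt ((c n)⁻¹ • hor w) (w 2)) with hb
  have haE : ∀ n, a n ∈ recCone f := fun n => by
    rw [(C n).recCone_iff, ha, LinearIsometryEquiv.apply_symm_apply]; exact vert_mem_recCone
  have hbE : ∀ n, b n ∈ recCone f := fun n => by
    refine smul_mem_recCone ?_ (by rw [inv_nonneg]; linarith)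
    rw [(C n).recCone_iff, LinearIsometryEquiv.apply_symm_apply, mem_recCone_dilate]
    simpa [smul_smul, (hc0 n).ne', pt_hor] using hw
  have hsum : ∀ n, ‖a n + b n‖ = (c n)⁻¹ * ((-w 2)⁻¹ * ‖hor w‖) := by
    intro n
    have : a n + b n = (Q n).symm (pt ((c n)⁻¹ • (-w 2)⁻¹ • hor w) 0) := by
      rw [ha, hb]
      simp only
      rw [← map_smul, ← map_add]
      congr 1
      refine space_ext ?_ ?_
      · simp only [map_add, map_smul, hor_vert, hor_pt, zero_add]
        rw [smul_comm]
      · simp [hneg.ne]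
    rw [this, LinearIsometryEquiv.norm_map, norm_pt_zero, norm_smul, norm_smul, Real.norm_eq_abs,
      Real.norm_eq_abs, abs_of_pos (inv_pos.2 (hc0 n)), abs_of_pos (inv_pos.2 (neg_pos.2 hneg))]
  have hctop : Tendsto c atTop atTop :=
    tendsto_atTop_mono (fun n => (by linarith [hc n] : (n : ℝ) ≤ c n)) tendsto_natCast_atTop_atTop
  have hlim0 : Tendsto (fun n => a n + b n) atTop (𝓝 0) := by
    rw [tendsto_zero_iff_norm_tendsto_zero]
    simp only [hsum]
    simpa using hctop.inv_tendsto_atTop.mul_const ((-w 2)⁻¹ * ‖hor w‖)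
  obtain ⟨l, hl, φ, hφ, hlim⟩ := (isCompact_sphere (0 : Space) 1).tendsto_subseq
    (x := a) (fun n => by simp [ha, norm_vert])
  have hlE : l ∈ recCone f :=
    (isClosed_recCone hf).mem_of_tendsto hlim (Eventually.of_forall fun n => haE _)
  have hlE' : -l ∈ recCone f := by
    have : Tendsto (fun n => b (φ n)) atTop (𝓝 (-l)) := by
      have := (hlim0.comp hφ.tendsto_atTop).sub hlim
      simpa using this
    exact (isClosed_recCone hf).mem_of_tendsto this (Eventually.of_forall fun n => hbE _)
  have := hp l hlE hlE'
  rw [this] at hl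
  simp at hl

section Pointed

variable {f : Plane → ℝ} {c : ℝ} {Q : Space ≃ₗᵢ[ℝ] Space} {σ : ℝ} {τ : Space}

/-- With heights nonnegative, a vector of the dilated cone is one of `recCone f` plus a nonnegative
multiple of `vert`. This inclusion makes Q map the closed set `recCone f` into itself, hence onto
itself. -/
lemma recCone_dilate_eq (hf : Continuous f) (hpos : ∀ w ∈ recCone f, 0 ≤ w 2) (hc : 1 < c)
    (C : Congruence f (fun x => f (c • x)) Q σ τ) : recCone (fun x => f (c • x)) = recCone f := by
  have hsub : ∀ w, w ∈ recCone (fun x => f (c • x)) → w ∈ recCone f := by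
    intro w hw
    rw [mem_recCone_dilate] at hw
    have h2 := hpos _ hw
    rw [pt_apply_two] at h2
    have h0 : 0 < c := by linarith
    have h3 := add_mem_recCone (smul_mem_recCone hw (inv_nonneg.2 h0.le))
      (smul_mem_recCone (vert_mem_recCone (f := f)) (r := (1 - c⁻¹) * w 2)
        (mul_nonneg (sub_nonneg.2 (inv_le_one_of_one_le₀ hc.le)) h2))
    convert h3 using 1
    refine space_ext ?_ ?_
    · simp [smul_smul, h0.ne']
    · simp; ring
  refine Set.Subset.antisymm hsub fun w hw => ?_
  have h1 := symm_mem_of_mapsTo Q (isClosed_recCone hf)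
    (fun v hv => hsub _ ((C.recCone_iff v).1 hv)) hw
  have h2 := (C.recCone_iff _).1 h1
  rwa [Q.apply_symm_apply] at h2

/-- Equality with the dilated cone lets heights be divided by c repeatedly; the limit stays in the
closed cone. -/
lemma horizontal_mem (hf : Continuous f) (hpos : ∀ w ∈ recCone f, 0 ≤ w 2) (hc : 1 < c)
    (C : Congruence f (fun x => f (c • x)) Q σ τ) {w : Space} (hw : w ∈ recCone f) :
    pt (hor w) 0 ∈ recCone f := by
  have h0 : 0 < c := by linarith
  have hstep : ∀ n : ℕ, pt (hor w) ((c⁻¹) ^ n * w 2) ∈ recCone f := by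
    intro n
    induction n with
    | zero => simpa [pt_hor] using hw
    | succ n ih =>
      rw [← recCone_dilate_eq hf hpos hc C, mem_recCone_dilate] at ih
      have := smul_mem_recCone ih (inv_nonneg.2 h0.le)
      convert this using 1
      refine space_ext ?_ ?_
      · simp [smul_smul, h0.ne']
      · simp [pow_succ]; ring
  have hlim : Tendsto (fun n : ℕ => pt (hor w) ((c⁻¹) ^ n * w 2)) atTop (𝓝 (pt (hor w) 0)) := by
    have h1 : Tendsto (fun n : ℕ => (c⁻¹) ^ n * w 2) atTop (𝓝 0) := by
      simpa using (tendsto_pow_atTop_nhds_zero_of_lt_one (inv_nonneg.2 h0.le)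
        (inv_lt_one_of_one_lt₀ hc)).mul_const (w 2)
    exact (continuous_pt.tendsto (hor w, 0)).comp (tendsto_const_nhds.prodMk_nhds h1)
  exact (isClosed_recCone hf).mem_of_tendsto hlim (Eventually.of_forall hstep)

/-- `u` spans an extreme ray of the recession cone. -/
def ExtremeRay (f : Plane → ℝ) (u : Space) : Prop :=
  u ∈ recCone f ∧ ∀ a ∈ recCone f, ∀ b ∈ recCone f, a + b = u → ∃ z : ℝ, a = z • u

/-- As Q preserves the cone, it suffices to decompose `vert`. The horizontal parts of the two
summands are opposite and both lie in the cone, so they vanish by pointedness. -/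
lemma extremeRay_symm_vert (hf : Continuous f) (hp : RecConePointed f)
    (hpos : ∀ w ∈ recCone f, 0 ≤ w 2) (hc : 1 < c)
    (C : Congruence f (fun x => f (c • x)) Q σ τ) : ExtremeRay f (Q.symm vert) := by
  have hQ : ∀ w, w ∈ recCone f ↔ Q w ∈ recCone f := by
    intro w
    rw [C.recCone_iff, recCone_dilate_eq hf hpos hc C]
  refine ⟨by rw [hQ, Q.apply_symm_apply]; exact vert_mem_recCone, fun a ha b hb hab => ?_⟩
  have hsum : Q a + Q b = vert := by rw [← map_add, hab, Q.apply_symm_apply]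
  have ha' := horizontal_mem hf hpos hc C ((hQ a).1 ha)
  have hb' := horizontal_mem hf hpos hc C ((hQ b).1 hb)
  have hh : hor (Q a) + hor (Q b) = 0 := by rw [← map_add, hsum, hor_vert]
  have hneg : pt (hor (Q b)) 0 = -pt (hor (Q a)) 0 :=
    space_ext (by simpa using (neg_eq_of_add_eq_zero_right hh).symm) (by simp)
  rw [hneg] at hb'
  have h0 := congrArg hor (hp _ ha' hb')
  rw [hor_pt, map_zero] at h0
  refine ⟨Q a 2, Q.injective ?_⟩
  rw [map_smul, Q.apply_symm_apply]
  exact space_ext (by simp [h0]) (by simp)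

/-- The vertical and horizontal parts of this extreme vector both lie in the cone, so it is purely
one or the other. If vertical, comparison with the identity congruence at c = 1 would make `f`
constant. -/
lemma symm_vert_horizontal (hf : Continuous f) (hp : RecConePointed f)
    (hpos : ∀ w ∈ recCone f, 0 ≤ w 2) (hc : 1 < c)
    (C : Congruence f (fun x => f (c • x)) Q σ τ) (hne : ∃ x y, f x ≠ f y) :
    (Q.symm vert) 2 = 0 := by
  set u := Q.symm vert with hu
  have hE := extremeRay_symm_vert hf hp hpos hc C
  rw [← hu] at hE
  by_contra h2
  obtain ⟨z, hz⟩ := hE.2 (u 2 • vert) (smul_mem_recCone vert_mem_recCone (hpos _ hE.1))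
    (pt (hor u) 0) (horizontal_mem hf hpos hc C hE.1)
    (space_ext (by simp) (by simp))
  have hnorm : |u 2| = |z| := by
    have := congrArg norm hz
    rwa [norm_smul, norm_smul, norm_vert, hu, LinearIsometryEquiv.norm_map, norm_vert, mul_one,
      mul_one] at this
  obtain ⟨x, y, hxy⟩ := hne
  have C1 : Congruence f (fun x => f ((1 : ℝ) • x)) (LinearIsometryEquiv.refl ℝ Space) 1 0 := by
    simpa using Congruence.refl f
  have hv : ∃ e : ℝ, (e = 1 ∨ e = -1) ∧ vert = e • u := by
    rcases abs_eq_abs.1 hnorm with h | h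
    · refine ⟨1, Or.inl rfl, ?_⟩
      rw [← h] at hz
      rw [one_smul]
      exact smul_right_injective _ h2 hz
    · refine ⟨-1, Or.inr rfl, ?_⟩
      rw [show z = u 2 * -1 by linarith, mul_smul] at hz
      exact smul_right_injective _ h2 hz
  obtain ⟨e, he, hv⟩ := hv
  exact hxy (const_of_axis hf (by linarith) one_pos hc.ne C C1 he hv x y)

lemma parallel_of_det_eq_zero {a b : Space} (ha : a 2 = 0) (hb : b 2 = 0) (na : ‖a‖ = 1)
    (nb : ‖b‖ = 1) (h : a 0 * b 1 = a 1 * b 0) : ∃ e : ℝ, (e = 1 ∨ e = -1) ∧ a = e • b := by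
  have na' : a 0 ^ 2 + a 1 ^ 2 = 1 := by
    have := EuclideanSpace.norm_sq_eq a
    rw [na] at this
    simp [Fin.sum_univ_three, ha] at this
    linarith
  have nb' : b 0 ^ 2 + b 1 ^ 2 = 1 := by
    have := EuclideanSpace.norm_sq_eq b
    rw [nb] at this
    simp [Fin.sum_univ_three, hb] at this
    linarith
  refine ⟨a 0 * b 0 + a 1 * b 1, ?_, ?_⟩
  · have : (a 0 * b 0 + a 1 * b 1 - 1) * (a 0 * b 0 + a 1 * b 1 + 1) = 0 := by
      linear_combination (b 0 ^ 2 + b 1 ^ 2) * na' + nb' - (a 0 * b 1 - a 1 * b 0) * h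
    rcases mul_eq_zero.1 this with h | h
    · left; linarith
    · right; linarith
  · ext i
    fin_cases i
    · simp; linear_combination -a 0 * nb' + b 1 * h
    · simp; linear_combination -a 1 * nb' - b 0 * h
    · simp [ha, hb]

lemma no_positive_relation {u v w : Space} (hu : ExtremeRay f u)
    (hv : ExtremeRay f v) (hw : ExtremeRay f w) (hdet : u 0 * w 1 - u 1 * w 0 ≠ 0) {p q r : ℝ}
    (p0 : 0 < p) (q0 : 0 < q) (r0 : 0 < r) (h : p • u + q • v = r • w) : False := by
  obtain ⟨z, hz⟩ := hw.2 ((r⁻¹ * p) • u) (smul_mem_recCone hu.1 (by positivity))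
    ((r⁻¹ * q) • v) (smul_mem_recCone hv.1 (by positivity)) (by
      rw [mul_smul, mul_smul, ← smul_add, h, inv_smul_smul₀ r0.ne'])
  have h0 := congrArg (fun x : Space => x 0) hz
  have h1 := congrArg (fun x : Space => x 1) hz
  simp only [PiLp.smul_apply, smul_eq_mul] at h0 h1
  refine hdet ?_
  have : r⁻¹ * p ≠ 0 := by positivity
  refine mul_left_cancel₀ this ?_
  linear_combination w 1 * h0 - w 0 * h1

/-- A pointed cone in the horizontal plane has at most two extreme rays. -/
lemma no_three_extremeRay (hp : RecConePointed f) {u v w : Space} (hu : ExtremeRay f u)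
    (hv : ExtremeRay f v) (hw : ExtremeRay f w) (u2 : u 2 = 0) (v2 : v 2 = 0) (w2 : w 2 = 0)
    (huv : u 0 * v 1 - u 1 * v 0 ≠ 0) (hvw : v 0 * w 1 - v 1 * w 0 ≠ 0)
    (hwu : w 0 * u 1 - w 1 * u 0 ≠ 0) : False := by
  -- This is Cramer's relation. Coefficients of equal sign would put a line in the cone; otherwise
  -- one vector is a positive combination of the other two, against extremality.
  have hrel : (v 0 * w 1 - v 1 * w 0) • u + (w 0 * u 1 - w 1 * u 0) • v +
      (u 0 * v 1 - u 1 * v 0) • w = 0 := by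
    ext i
    fin_cases i
    · simp; ring
    · simp; ring
    · simp [u2, v2, w2]
  have hneg : ∀ {u v w : Space}, ExtremeRay f u → ExtremeRay f v → ExtremeRay f w → u ≠ 0 →
      ∀ {p q r : ℝ}, 0 < p → 0 < q → 0 < r → p • u + q • v + r • w ≠ 0 := by
    intro u v w hu hv hw hu0 p q r hp0 hq0 hr0 h
    have := hp (p • u) (smul_mem_recCone hu.1 hp0.le) (by
      rw [neg_eq_of_add_eq_zero_right (by rwa [add_assoc] at h : p • u + (q • v + r • w) = 0)]
      exact add_mem_recCone (smul_mem_recCone hv.1 hq0.le) (smul_mem_recCone hw.1 hr0.le))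
    exact (smul_ne_zero hp0.ne' hu0) this
  have hu0 : u ≠ 0 := by
    rintro rfl
    simp at huv
  set p := v 0 * w 1 - v 1 * w 0
  set q := w 0 * u 1 - w 1 * u 0
  set r := u 0 * v 1 - u 1 * v 0
  have hwu' : u 0 * w 1 - u 1 * w 0 ≠ 0 := fun h => hwu (by linarith)
  have huv' : v 0 * u 1 - v 1 * u 0 ≠ 0 := fun h => huv (by linarith)
  rcases lt_or_gt_of_ne hvw with p0 | p0 <;> rcases lt_or_gt_of_ne hwu with q0 | q0 <;>
    rcases lt_or_gt_of_ne huv with r0 | r0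
  · refine hneg hu hv hw hu0 (neg_pos.2 p0) (neg_pos.2 q0) (neg_pos.2 r0) ?_
    rw [← neg_eq_zero, ← hrel]; module
  · exact no_positive_relation hu hv hw hwu' (neg_pos.2 p0) (neg_pos.2 q0) r0
      (by rw [← sub_eq_zero, ← neg_eq_zero, ← hrel]; module)
  · exact no_positive_relation hu hw hv huv (neg_pos.2 p0) (neg_pos.2 r0) q0
      (by rw [← sub_eq_zero, ← neg_eq_zero, ← hrel]; module)
  · exact no_positive_relation hv hw hu huv' q0 r0 (neg_pos.2 p0)
      (by rw [← sub_eq_zero, ← hrel]; module)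
  · exact no_positive_relation hv hw hu huv' (neg_pos.2 q0) (neg_pos.2 r0) p0
      (by rw [← sub_eq_zero, ← neg_eq_zero, ← hrel]; module)
  · exact no_positive_relation hu hw hv huv p0 r0 (neg_pos.2 q0)
      (by rw [← sub_eq_zero, ← hrel]; module)
  · exact no_positive_relation hu hv hw hwu' p0 q0 (neg_pos.2 r0)
      (by rw [← sub_eq_zero, ← hrel]; module)
  · exact hneg hu hv hw hu0 p0 q0 r0 hrel

end Pointed

/-- A rigid function whose recession cone contains no line is constant. -/
theorem const_of_pointed {f : Plane → ℝ} (hf : Continuous f) (hp : RecConePointed f)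
    (h : ∃ᶠ c : ℝ in atTop, ∃ Q σ τ, Congruence f (fun x => f (c • x)) Q σ τ) (x y : Plane) :
    f x = f y := by
  by_contra hxy
  have hpos : ∀ w ∈ recCone f, 0 ≤ w 2 := fun w hw => height_nonneg hf hp h hw
  obtain ⟨c₁, h₁, Q₁, σ₁, τ₁, C₁⟩ := (frequently_atTop.1 h) 2
  obtain ⟨c₂, h₂, Q₂, σ₂, τ₂, C₂⟩ := (frequently_atTop.1 h) (c₁ + 1)
  obtain ⟨c₃, h₃, Q₃, σ₃, τ₃, C₃⟩ := (frequently_atTop.1 h) (c₂ + 1)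
  have hhor : ∀ {c : ℝ} {Q : Space ≃ₗᵢ[ℝ] Space} {σ τ}, 1 < c →
      Congruence f (fun x => f (c • x)) Q σ τ → (Q.symm vert) 2 = 0 := fun hc C =>
    symm_vert_horizontal hf hp hpos hc C ⟨x, y, hxy⟩
  have hdet : ∀ {c c' : ℝ} {Q Q' : Space ≃ₗᵢ[ℝ] Space} {σ σ' τ τ'}, 1 < c → 1 < c' → c' ≠ c →
      Congruence f (fun x => f (c • x)) Q σ τ → Congruence f (fun x => f (c' • x)) Q' σ' τ' →
      (Q'.symm vert) 0 * (Q.symm vert) 1 - (Q'.symm vert) 1 * (Q.symm vert) 0 ≠ 0 := by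
    intro c c' Q Q' σ σ' τ τ' hc hc' hne C C' hd
    obtain ⟨e, he, hv⟩ := parallel_of_det_eq_zero (hhor hc' C') (hhor hc C)
      (by rw [LinearIsometryEquiv.norm_map, norm_vert])
      (by rw [LinearIsometryEquiv.norm_map, norm_vert]) (sub_eq_zero.1 hd)
    exact hxy (const_of_axis hf (by linarith) (by linarith) hne C C' he hv x y)
  have g₁ : 1 < c₁ := by linarith
  have g₂ : 1 < c₂ := by linarith
  have g₃ : 1 < c₃ := by linarith
  exact no_three_extremeRay hp (extremeRay_symm_vert hf hp hpos g₁ C₁)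
    (extremeRay_symm_vert hf hp hpos g₂ C₂) (extremeRay_symm_vert hf hp hpos g₃ C₃)
    (hhor g₁ C₁) (hhor g₂ C₂) (hhor g₃ C₃)
    (hdet g₂ g₁ (by linarith : c₁ < c₂).ne C₂ C₁) (hdet g₃ g₂ (by linarith : c₂ < c₃).ne C₃ C₂)
    (hdet g₁ g₃ (by linarith : c₁ < c₃).ne' C₁ C₃)

/-! ### Cylinders and reduction to the plane -/

/-- The coordinate of `X` along the horizontal unit vector `(-q, p, 0)`. -/
def transverse (p q : ℝ) (X : Space) : ℝ := p * X 1 - q * X 0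

/-- The height of `X` above the plane of slope `s` in direction `(p, q)`. -/
def elevation (p q s : ℝ) (X : Space) : ℝ := X 2 - s * (p * X 0 + q * X 1)

lemma transverse_add_smul (p q b : ℝ) (X Y : Space) :
    transverse p q (b • X + Y) = b * transverse p q X + transverse p q Y := by
  simp [transverse]; ring

lemma elevation_add_smul (p q s b : ℝ) (X Y : Space) :
    elevation p q s (b • X + Y) = b * elevation p q s X + elevation p q s Y := by
  simp [elevation]; ring

/-- The inner product of two vectors orthogonal to `(p, q, s)`. -/
lemma inner_of_orthogonal {p q s : ℝ} (hpq : p ^ 2 + q ^ 2 = 1) {X Y : Space}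
    (hX : inner ℝ X !₂[p, q, s] = 0) (hY : inner ℝ Y !₂[p, q, s] = 0) :
    inner ℝ X Y = transverse p q X * transverse p q Y +
      elevation p q s X / √(1 + s ^ 2) * (elevation p q s Y / √(1 + s ^ 2)) := by
  have hk : √(1 + s ^ 2) * √(1 + s ^ 2) = 1 + s ^ 2 := Real.mul_self_sqrt (by positivity)
  have hk0 : 1 + s ^ 2 ≠ 0 := by positivity
  rw [div_mul_div_comm, hk]
  simp [PiLp.inner_apply, Fin.sum_univ_three] at hX hY ⊢
  have eX : elevation p q s X = X 2 * (1 + s ^ 2) := by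
    unfold elevation; linear_combination -s * hX
  have eY : elevation p q s Y = Y 2 * (1 + s ^ 2) := by
    unfold elevation; linear_combination -s * hY
  rw [eX, eY, show X 2 * (1 + s ^ 2) * (Y 2 * (1 + s ^ 2)) / (1 + s ^ 2) =
    X 2 * Y 2 * (1 + s ^ 2) by field_simp]
  unfold transverse
  linear_combination (-X 0 * Y 0 - X 1 * Y 1) * hpq + (p * Y 0 + q * Y 1) * hX - s * X 2 * hY

section Cylinder

variable {f : Plane → ℝ} {g : ℝ → ℝ} {p q s : ℝ}

lemma mem_recCone_cylinder (hpq : p ^ 2 + q ^ 2 = 1)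
    (hf : ∀ x : Plane, f x = s * (p * x 0 + q * x 1) + g (p * x 1 - q * x 0)) {w : Space} :
    w ∈ recCone f ↔ SlopeBound g (transverse p q w) (elevation p q s w) := by
  constructor
  · intro h b t ht
    have := h !₂[-q * b, p * b] t ht
    rw [hf, hf] at this
    simp only [PiLp.add_apply, PiLp.smul_apply, smul_eq_mul, hor_apply_zero, hor_apply_one] at this
    simp at this
    rw [show p * (p * b + t * w 1) - q * (-(q * b) + t * w 0) = b + t * transverse p q w by
      unfold transverse; linear_combination b * hpq,
      show p * (p * b) + q * (q * b) = b by linear_combination b * hpq] at this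
    unfold elevation
    linarith
  · intro h x t ht
    have := h (p * x 1 - q * x 0) t ht
    rw [hf, hf]
    simp only [PiLp.add_apply, PiLp.smul_apply, smul_eq_mul, hor_apply_zero, hor_apply_one]
    rw [show p * (x 1 + t * w 1) - q * (x 0 + t * w 0) =
      p * x 1 - q * x 0 + t * transverse p q w by unfold transverse; ring]
    unfold elevation at this
    linarith

lemma mem_graph_cylinder
    (hf : ∀ x : Plane, f x = s * (p * x 0 + q * x 1) + g (p * x 1 - q * x 0)) {X : Space} :
    X 2 = f (hor X) ↔ elevation p q s X = g (transverse p q X) := by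
  rw [hf]
  simp only [hor_apply_zero, hor_apply_one, elevation, transverse]
  constructor <;> intro h <;> linarith

/-- If `g` is not affine, the recession cone of the cylinder contains only one line. -/
lemma line_unique (hpq : p ^ 2 + q ^ 2 = 1)
    (hf : ∀ x : Plane, f x = s * (p * x 0 + q * x 1) + g (p * x 1 - q * x 0))
    (hg : ¬ ∃ m, ∀ x t, g (x + t) = g x + t * m) {w : Space} (h : w ∈ recCone f)
    (h' : -w ∈ recCone f) : ∃ a : ℝ, w = a • !₂[p, q, s] := by
  rw [mem_recCone_cylinder hpq hf] at h h'
  have e1 : transverse p q (-w) = -transverse p q w := by simp [transverse]; ring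
  have e2 : elevation p q s (-w) = -elevation p q s w := by simp [elevation]; ring
  rw [e1, e2] at h'
  set B := transverse p q w with hB
  set Y := elevation p q s w with hY
  -- A line with nonzero transverse component would prescribe every increment of `g`, making it
  -- affine.
  have hB0 : B = 0 := by
    by_contra hne
    refine hg ⟨Y / B, fun x t => ?_⟩
    have main : ∀ x t, 0 ≤ t → g (x + t * B) = g x + t * Y := by
      intro x t ht
      have h1 := h x t ht
      have h2 := h' (x + t * B) t ht
      rw [show x + t * B + t * -B = x by ring] at h2
      linarith
    have main' : ∀ x t, g (x + t * B) = g x + t * Y := by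
      intro x t
      rcases le_total 0 t with ht | ht
      · exact main x t ht
      · have := main (x + t * B) (-t) (by linarith)
        rw [show x + t * B + -t * B = x by ring] at this
        linarith
    have := main' x (t / B)
    rw [div_mul_cancel₀ _ hne] at this
    rw [this]
    ring
  rw [hB0] at h h'
  rw [neg_zero] at h'
  have h1 := SlopeBound.zero_left.1 h
  have h2 := SlopeBound.zero_left.1 h'
  have hY0 : Y = 0 := by linarith
  unfold transverse at hB
  unfold elevation at hY
  refine ⟨p * w 0 + q * w 1, ?_⟩
  ext i
  fin_cases i
  · simp; linear_combination -w 0 * hpq + q * hB - q * hB0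
  · simp; linear_combination -w 1 * hpq - p * hB + p * hB0
  · simp; linarith

lemma exists_rotation_of_orthonormal {α β γ δ : ℝ} (h1 : α * α + β * β = 1)
    (h2 : γ * γ + δ * δ = 1) (h3 : α * γ + β * δ = 0) :
    ∃ η : ℝ, (η = 1 ∨ η = -1) ∧ γ = -η * β ∧ δ = η * α := by
  refine ⟨α * δ - β * γ, ?_, ?_, ?_⟩
  · have : (α * δ - β * γ - 1) * (α * δ - β * γ + 1) = 0 := by
      linear_combination (γ * γ + δ * δ) * h1 + h2 - (α * γ + β * δ) * h3
    rcases mul_eq_zero.1 this with h | h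
    · left; linarith
    · right; linarith
  · linear_combination -γ * h1 + α * h3
  · linear_combination -δ * h1 + β * h3

/-- A congruence between a cylinder over `g` and its dilate induces a planar congruence. -/
lemma exists_planarCongruence (hpq : p ^ 2 + q ^ 2 = 1)
    (hf : ∀ x : Plane, f x = s * (p * x 0 + q * x 1) + g (p * x 1 - q * x 0))
    (hg : ¬ ∃ m, ∀ x t, g (x + t) = g x + t * m) {c : ℝ}
    {Q : Space ≃ₗᵢ[ℝ] Space} {σ : ℝ} {τ : Space}
    (C : Congruence f (fun x => f (c • x)) Q σ τ) :
    ∃ α β η σ τ₁ τ₂,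
      PlanarCongruence g (√(1 + s ^ 2)) (√(1 + s ^ 2 * c ^ 2)) c α β η σ τ₁ τ₂ := by
  have hf' : ∀ x : Plane, f (c • x) =
      (s * c) * (p * x 0 + q * x 1) + (fun b => g (c * b)) (p * x 1 - q * x 0) := by
    intro x
    rw [hf]
    simp only [PiLp.smul_apply, smul_eq_mul]
    rw [show p * (c * x 1) - q * (c * x 0) = c * (p * x 1 - q * x 0) by ring]
    ring
  have hSB : ∀ b y, SlopeBound (fun b => g (c * b)) b y ↔ SlopeBound g (c * b) y := by
    intro b y
    rcases eq_or_ne c 0 with rfl | hc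
    · simp [SlopeBound]
    constructor
    · intro h x t ht
      have := h (x / c) t ht
      simp only at this
      rwa [show c * (x / c + t * b) = x + t * (c * b) by field_simp,
        mul_div_cancel₀ _ hc] at this
    · intro h x t ht
      have := h (c * x) t ht
      simp only
      rwa [show c * (x + t * b) = c * x + t * (c * b) by ring]
  have hcone : ∀ w, w ∈ recCone (fun x => f (c • x)) ↔
      SlopeBound g (c * transverse p q w) (elevation p q (s * c) w) := fun w =>
    (mem_recCone_cylinder (g := fun b => g (c * b)) hpq hf').trans (hSB _ _)
  have hgraph : ∀ X : Space, X 2 = f (c • hor X) ↔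
      elevation p q (s * c) X = g (c * transverse p q X) := fun X =>
    mem_graph_cylinder (f := fun x => f (c • x)) (g := fun b => g (c * b)) hf'
  set W : Space := !₂[p, q, s] with hW
  set W' : Space := !₂[p, q, s * c] with hW'
  -- W' spans a line in the dilated cone, so its preimage spans a line in `recCone f`, where the
  -- only line is that of W.
  have hline : ∃ a : ℝ, Q.symm W' = a • W := by
    have e1 : transverse p q W' = 0 := by simp [transverse, hW']; ring
    have e2 : elevation p q (s * c) W' = 0 := by
      simp [elevation, hW']; linear_combination -s * c * hpq
    have e3 : transverse p q (-W') = 0 := by simp [transverse, hW']; ring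
    have e4 : elevation p q (s * c) (-W') = 0 := by
      simp [elevation, hW']; linear_combination s * c * hpq
    refine line_unique hpq hf hg ?_ ?_
    · rw [C.recCone_iff, Q.apply_symm_apply, hcone, e1, e2, mul_zero,
        SlopeBound.zero_left]
    · rw [C.recCone_iff, map_neg, Q.apply_symm_apply, hcone, e3, e4,
        mul_zero, SlopeBound.zero_left]
  obtain ⟨a, ha⟩ := hline
  have horth : ∀ X : Space, inner ℝ X W = 0 → inner ℝ (Q X) W' = 0 := by
    intro X hX
    rw [show W' = a • Q W by rw [← map_smul, ← ha, Q.apply_symm_apply], real_inner_smul_right,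
      Q.inner_map_map, hX, mul_zero]
  set k := √(1 + s ^ 2) with hk
  set k' := √(1 + s ^ 2 * c ^ 2) with hk'
  have hk'' : √(1 + (s * c) ^ 2) = k' := by rw [mul_pow]
  have hk0 : 0 < k := by positivity
  have hk0' : 0 < k' := by positivity
  have hkk : k * k = 1 + s ^ 2 := Real.mul_self_sqrt (by positivity)
  -- The vectors e, n form an orthonormal basis of W⊥, with coordinates `transverse` and `elevation`
  -- / k. Q maps W⊥ into W'⊥, where k' replaces k.
  set e : Space := !₂[-q, p, 0] with he
  set n : Space := !₂[-(s * p) / k, -(s * q) / k, 1 / k] with hn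
  have heW : inner ℝ e W = 0 := by
    simp [PiLp.inner_apply, Fin.sum_univ_three, he, hW]; ring
  have hnW : inner ℝ n W = 0 := by
    simp [PiLp.inner_apply, Fin.sum_univ_three, hn, hW]
    field_simp
    linear_combination -s * hpq
  have te : transverse p q e = 1 := by simp [transverse, he]; linear_combination hpq
  have tn : transverse p q n = 0 := by simp [transverse, hn]; ring
  have ee : elevation p q s e = 0 := by simp [elevation, he]; ring_nf; simp
  have en : elevation p q s n = k := by
    simp [elevation, hn]
    field_simp
    linear_combination s ^ 2 * hpq - hkk
  have iee := inner_of_orthogonal hpq heW heW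
  have inn := inner_of_orthogonal hpq hnW hnW
  have ien := inner_of_orthogonal hpq heW hnW
  rw [te, ee] at iee
  rw [tn, en, ← hk, div_self hk0.ne'] at inn
  rw [te, ee, tn, en] at ien
  have jee := inner_of_orthogonal hpq (horth e heW) (horth e heW)
  have jnn := inner_of_orthogonal hpq (horth n hnW) (horth n hnW)
  have jen := inner_of_orthogonal hpq (horth e heW) (horth n hnW)
  rw [Q.inner_map_map, hk''] at jee jnn jen
  rw [iee] at jee
  rw [inn] at jnn
  rw [ien] at jen
  set α := transverse p q (Q e) with hα
  set β := elevation p q (s * c) (Q e) / k' with hβ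
  set γ := transverse p q (Q n) with hγ
  set δ := elevation p q (s * c) (Q n) / k' with hδ
  obtain ⟨η, hη, hγ', hδ'⟩ := exists_rotation_of_orthonormal (α := α) (β := β) (γ := γ) (δ := δ)
    (by rw [← jee]; ring) (by rw [← jnn]; ring) (by rw [← jen]; ring)
  have hQ : ∀ b y : ℝ, Q (b • e + y • n) = b • Q e + (y • Q n + 0) := fun b y => by
    rw [map_add, map_smul, map_smul, add_zero]
  have t0 : transverse p q 0 = 0 := by simp [transverse]
  have e0 : ∀ s, elevation p q s 0 = 0 := by simp [elevation]
  have hP : ∀ b y : ℝ, b • e + y • n = b • e + (y • n + 0) := fun b y => by rw [add_zero]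
  have tP : ∀ b y, transverse p q (b • e + y • n) = b := fun b y => by
    rw [hP, transverse_add_smul, transverse_add_smul, te, tn, t0]; ring
  have eP : ∀ b y, elevation p q s (b • e + y • n) = k * y := fun b y => by
    rw [hP, elevation_add_smul, elevation_add_smul, ee, en, e0]; ring
  have tQ : ∀ b y, transverse p q (Q (b • e + y • n)) = α * b - η * β * y := fun b y => by
    rw [hQ, transverse_add_smul, transverse_add_smul, t0, ← hα, ← hγ, hγ']; ring
  have eQ : ∀ b y, elevation p q (s * c) (Q (b • e + y • n)) = k' * (β * b + η * α * y) :=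
    fun b y => by
    rw [hQ, elevation_add_smul, elevation_add_smul, e0,
      show elevation p q (s * c) (Q e) = k' * β by rw [hβ]; field_simp,
      show elevation p q (s * c) (Q n) = k' * δ by rw [hδ]; field_simp, hδ']
    ring
  refine ⟨α, β, η, σ, transverse p q τ, elevation p q (s * c) τ / k', ?_, hη, C.sign, ?_, ?_⟩
  · linear_combination -jee
  · intro b y
    have := C.graph_iff (b • e + y • n)
    rw [mem_graph_cylinder hf, hgraph, tP, eP, transverse_add_smul,
      elevation_add_smul, tQ, eQ] at this
    rw [this, show k' * (σ * (β * b + η * α * y) + elevation p q (s * c) τ / k') =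
      σ * (k' * (β * b + η * α * y)) + elevation p q (s * c) τ by field_simp]
  · intro b y
    have := C.recCone_iff (b • e + y • n)
    rwa [mem_recCone_cylinder hpq hf, hcone, tP, eP, tQ, eQ] at this

end Cylinder

/-- A function whose recession cone contains a line is a cylinder. -/
lemma exists_cylinder {f : Plane → ℝ} (hp : ¬ RecConePointed f) :
    ∃ p q s : ℝ, p ^ 2 + q ^ 2 = 1 ∧ ∀ x : Plane,
      f x = s * (p * x 0 + q * x 1) + f !₂[-q * (p * x 1 - q * x 0), p * (p * x 1 - q * x 0)] := by
  unfold RecConePointed at hp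
  push Not at hp
  obtain ⟨w, hw, hw', hne⟩ := hp
  have hh : hor w ≠ 0 := by
    intro h
    have h1 := nonneg_of_mem_recCone_of_hor_eq_zero hw h
    have h2 := nonneg_of_mem_recCone_of_hor_eq_zero hw' (by rw [map_neg, h, neg_zero])
    rw [PiLp.neg_apply] at h2
    exact hne (space_ext (by rw [h, map_zero]) (by rw [PiLp.zero_apply]; linarith))
  have hn : 0 < ‖hor w‖ := norm_pos_iff.2 hh
  set r := ‖hor w‖⁻¹ with hr
  have hr0 : 0 < r := inv_pos.2 hn
  have h1 := smul_mem_recCone hw hr0.le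
  have h2 := smul_mem_recCone hw' hr0.le
  -- The inequalities for w and −w are opposite, so `f` has exact slope along w.
  have hpos : ∀ x t, 0 ≤ t → f (x + t • (r • hor w)) = f x + t * (r * w 2) := by
    intro x t ht
    have g1 := h1 x t ht
    have g2 := h2 (x + t • (r • hor w)) t ht
    rw [map_smul, PiLp.smul_apply, smul_eq_mul] at g1
    rw [map_smul, map_neg, smul_neg, smul_neg, add_neg_cancel_right, PiLp.smul_apply,
      PiLp.neg_apply, smul_eq_mul] at g2
    linarith
  have hall : ∀ x t, f (x + t • (r • hor w)) = f x + t * (r * w 2) := by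
    intro x t
    rcases le_total 0 t with ht | ht
    · exact hpos x t ht
    · have := hpos (x + t • (r • hor w)) (-t) (by linarith)
      rw [neg_smul, add_neg_cancel_right] at this
      linarith
  have hpq : (r * w 0) ^ 2 + (r * w 1) ^ 2 = 1 := by
    have h3 := EuclideanSpace.norm_sq_eq (hor w)
    simp [Fin.sum_univ_two] at h3
    rw [mul_pow, mul_pow, ← mul_add, ← h3, hr, ← mul_pow, inv_mul_cancel₀ hn.ne', one_pow]
  refine ⟨r * w 0, r * w 1, r * w 2, hpq, fun x => ?_⟩
  set p := r * w 0 with hp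
  set q := r * w 1 with hq
  have := hall !₂[-q * (p * x 1 - q * x 0), p * (p * x 1 - q * x 0)] (p * x 0 + q * x 1)
  have e : (!₂[-q * (p * x 1 - q * x 0), p * (p * x 1 - q * x 0)] : Plane) +
      (p * x 0 + q * x 1) • (r • hor w) = x := by
    ext i
    fin_cases i
    · simp [← hp]; linear_combination x 0 * hpq
    · simp [← hq]; linear_combination x 1 * hpq
  rw [e] at this
  linarith

/-! ### Both directions of the theorem -/

/-- A continuous function congruent to arbitrarily large dilates of itself is affine. -/
theorem affine_of_congruence {f : Plane → ℝ} (hf : Continuous f)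
    (h : ∃ᶠ c : ℝ in atTop, ∃ Q σ τ, Congruence f (fun x => f (c • x)) Q σ τ) :
    ∃ a b d : ℝ, ∀ x : Plane, f x = a + b * x 0 + d * x 1 := by
  by_cases hp : RecConePointed f
  · exact ⟨f 0, 0, 0, fun x => by rw [const_of_pointed hf hp h x 0]; ring⟩
  · obtain ⟨p, q, s, hpq, hcyl⟩ := exists_cylinder hp
    set g : ℝ → ℝ := fun b => f !₂[-q * b, p * b] with hgdef
    have hgc : Continuous g := by
      refine hf.comp ((PiLp.continuous_toLp 2 _).comp (continuous_pi fun i => ?_))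
      fin_cases i <;> simp <;> fun_prop
    have hg : ∃ m, ∀ x t, g (x + t) = g x + t * m := by
      by_contra hg
      exact hg (affine_of_planarCongruence hgc (s := s) (h.mono fun c ⟨Q, σ, τ, C⟩ =>
        exists_planarCongruence hpq hcyl hg C))
    obtain ⟨m, hm⟩ := hg
    refine ⟨g 0, s * p - m * q, s * q + m * p, fun x => ?_⟩
    have h0 := hm 0 (p * x 1 - q * x 0)
    rw [zero_add] at h0
    have h1 : f x = s * (p * x 0 + q * x 1) + g (p * x 1 - q * x 0) := hcyl x
    rw [h1, h0]
    ring

lemma affine_of_rigid {f : Plane → ℝ} (hf : Continuous f) {C : Set ℝ}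
    (hC : CondensatesToInfinity C) (h : HorizontallyRigidFor C f) :
    ∃ a b d : ℝ, ∀ x : Plane, f x = a + b * x 0 + d * x 1 := by
  refine affine_of_congruence hf (frequently_atTop.2 fun r => ?_)
  obtain ⟨c, hcC, hc⟩ : (C ∩ Set.Ioi r).Nonempty :=
    Set.nonempty_iff_ne_empty.2 fun h0 => hC r (by rw [h0]; exact Set.countable_empty)
  obtain ⟨φ, -, hφ⟩ := h c hcC
  exact ⟨c, le_of_lt hc, exists_congruence hf (by fun_prop) hφ⟩

/-- Affine functions are rigid: a reflection carries one plane to a parallel of the other. -/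
lemma rigid_of_affine {f : Plane → ℝ} {a b d : ℝ} (h : ∀ x : Plane, f x = a + b * x 0 + d * x 1)
    (C : Set ℝ) : HorizontallyRigidFor C f := by
  intro c _
  have hgraph : ∀ (c : ℝ) (p : Space),
      p ∈ euclideanGraph (fun x => f (c • x)) ↔ inner ℝ !₂[-(c * b), -(c * d), 1] p = a := by
    intro c p
    rw [mem_graph, h]
    simp [PiLp.inner_apply, Fin.sum_univ_three]
    constructor <;> intro h <;> linarith
  set n : Space := !₂[-(1 * b), -(1 * d), 1] with hn
  set m : Space := !₂[-(c * b), -(c * d), 1] with hm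
  have hn0 : 0 < ‖n‖ := norm_pos_iff.2 fun h0 => by
    have := congrArg (fun p : Space => p 2) h0
    simp [hn] at this
  have hm0 : 0 < ‖m‖ := norm_pos_iff.2 fun h0 => by
    have := congrArg (fun p : Space => p 2) h0
    simp [hm] at this
  -- The normals n and m are rescaled to equal length, so a reflection exchanges them.
  set R := Submodule.reflection (Submodule.span ℝ {‖m‖ • n - ‖n‖ • m})ᗮ with hR
  have hRn : R (‖m‖ • n) = ‖n‖ • m := Submodule.reflection_sub (by simp [norm_smul, mul_comm])
  have hinner : ∀ p, ‖n‖ * inner ℝ m (R p) = ‖m‖ * inner ℝ n p := by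
    intro p
    rw [← real_inner_smul_left, ← real_inner_smul_left, ← hRn, R.inner_map_map]
  -- After R the constant is ‖m‖ / ‖n‖ · a. Since m has inner product 1 with `vert`, this shift
  -- restores a.
  set τ : Space := ((1 - ‖m‖ / ‖n‖) * a) • vert with hτ
  have hmτ : inner ℝ m τ = (1 - ‖m‖ / ‖n‖) * a := by
    rw [hτ, real_inner_smul_right, inner_vert]
    simp [hm]
  refine ⟨R.toIsometryEquiv.trans (IsometryEquiv.addRight τ), trivial, ?_⟩
  set φ : Space ≃ᵢ Space := R.toIsometryEquiv.trans (IsometryEquiv.addRight τ) with hφ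
  have key : ∀ p, p ∈ euclideanGraph f ↔ φ p ∈ euclideanGraph fun x => f (c • x) := by
    intro p
    have h1 := hgraph 1 p
    simp only [one_smul] at h1
    rw [h1, hgraph c, show φ p = R p + τ from rfl, inner_add_right, hmτ]
    have := hinner p
    have e : inner ℝ m (R p) = ‖m‖ / ‖n‖ * inner ℝ n p := by
      field_simp
      linarith
    rw [e]
    have hpos : 0 < ‖m‖ / ‖n‖ := by positivity
    constructor
    · intro h
      rw [h]; ring
    · intro h
      exact mul_left_cancel₀ hpos.ne' (by linear_combination h)
  ext y
  constructor
  · rintro ⟨p, hp, rfl⟩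
    exact (key p).1 hp
  · intro hy
    obtain ⟨p, rfl⟩ := φ.surjective y
    exact ⟨p, (key p).2 hy, rfl⟩

lemma condensatesToInfinity_Ioi : CondensatesToInfinity (Set.Ioi 0) := by
  intro r h
  rw [Set.Ioi_inter_Ioi] at h
  rw [← Cardinal.le_aleph0_iff_set_countable, Cardinal.mk_Ioi_real] at h
  exact absurd h (not_le.2 Cardinal.aleph0_lt_continuum)

theorem mainTheorem1 (f : EuclideanSpace ℝ (Fin 2) → ℝ) (hf : Continuous f) :
    (∀ C : Set ℝ, C ⊆ Set.Ioi 0 → CondensatesToInfinity C →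
      (HorizontallyRigidFor C f ↔
        ∃ a b d : ℝ, ∀ x : EuclideanSpace ℝ (Fin 2), f x = a + b * x 0 + d * x 1)) ∧
    (HorizontallyRigid f ↔
      ∃ a b d : ℝ, ∀ x : EuclideanSpace ℝ (Fin 2), f x = a + b * x 0 + d * x 1) := by
  have main : ∀ C : Set ℝ, CondensatesToInfinity C → (HorizontallyRigidFor C f ↔
      ∃ a b d : ℝ, ∀ x : EuclideanSpace ℝ (Fin 2), f x = a + b * x 0 + d * x 1) :=
    fun C hC => ⟨affine_of_rigid hf hC, fun ⟨_, _, _, h⟩ => rigid_of_affine h C⟩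
  exact ⟨fun C _ hC => main C hC, main _ condensatesToInfinity_Ioi⟩
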